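/- **Setting.** A network model has internal signals $\mathcal W=\{w_1,\dots,w_L\}$, measured excitations $r$ (with $K\le L$ components) and a white noise vector $\tilde e$ of dimension $|\mathcal C|$, where $\mathcal C\subseteq\mathcal W$ is the set of measured internal signals: $$w=G(q)w+Rr+\begin{bmatrix}\tilde H(q)\\0\end{bmatrix}\tilde e,\qquad w_{\mathcal C}=Cw .$$ Here $G$ and the square matrix $\tilde H$ consist of real rational transfer functions, $R$ consists of $K$ distinct columns of the identity matrix, $C$ selects the rows of $\mathcal C$, the noise enters the measured signals only, and $\tilde e$ has covariance $\tilde\Lambda$. Put $T=(I-G)^{-1}$, $X=[R\ \ [\tilde H;0]]$, and $\Phi=T[\tilde H;0]\tilde\Lambda[\tilde H;0]^\star T^\star$ on the unit circle. A model set $\mathcal M$ is a family of such models $(G(q,\theta),R,C,\tilde H(q,\theta),\tilde\Lambda(\theta))$, $\theta\in\Theta\subseteq\mathbb R^n$, such that for every $\theta\in\Theta$: $G$ is proper, stable and has zero diagonal; $T$ is stable; all principal minors of $\lim_{z\to\infty}(I-G(z))$ are nonzero; $\tilde H$ is proper, stable, monic ($\tilde H(\infty)=I$) and minimum phase; $\tilde\Lambda$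 is real positive semidefinite; and the transfer matrix $CT[\tilde H;0]$ from $\tilde e$ to $w_{\mathcal C}$ is minimum phase. (A square transfer matrix is minimum phase if it is invertible and its inverse has no pole with $|z|>1$.) The following is also assumed. * For every $\theta\in\Theta$, $C\Phi(\omega)C^\top$ has full rank for almost all $\omega$. * The entries of $G$ and $\tilde H$ are parameterized independently: each is a quotient of polynomials in $z$ whose coefficients are polynomials in its own parameters, and different entries share no parameter. * Either all entries of $G(q,\theta)$ are strictly proper for all $\theta$, or $\tilde\Lambda(\theta)$ is diagonal for all $\theta$ and there is one permutation matrix $P$ such that $P\,G(\infty,\theta)P^\top$ is lower triangular for all $\theta$. * Every submatrix of $[G-I\ \ X]$ that does not depend on $\theta$ has rank equal to its structural rank (the maximum rank over all matrices with the same nonzero pattern). An entry is *known* if it does not depend on $\theta\in\Theta$, and *unknown* otherwise. The graph of $\mathcal M$ has as vertices $\mathcal W$ and the set $\mathcal X$ of the external signals (the components of $r$ and $\tilde e$), and one edge for each entry of $G$ (from $w_b$ to $w_a$ for $G_{ab}$), of $R$ and of $[\tilde H;0]$ (from the external signal to $w_a$) that is not identically zero on $\Theta$. Let $\mathcal X_j$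 be the set of external signals without an unknown edge to $w_j$. Let $\mathcal N_i^+$ be the set of out-neighbors of $w_i$, except those to which $w_i$ has a known edge and which are also excited by an external signal of out-degree one through a known edge. A path repeats no vertex, and a single vertex is a path. $b_{A\to B}$ is the maximum number of mutually vertex disjoint paths from $A$ to $B$ (end points included). A vertex set $D$ is an $A-B$ disconnecting set if it meets every path from $A$ to $B$; it may contain vertices of $A\cup B$. The module $G_{ji}$ is *generically identifiable* in $\mathcal M$ from $(w_{\mathcal C},r)$ if for all $\theta_0\in\Theta$ outside a Lebesgue null set and all $\theta_1\in\Theta$, the equalities $CT(q,\theta_0)R=CT(q,\theta_1)R$ and $C\Phi(\omega,\theta_0)C^\top=C\Phi(\omega,\theta_1)C^\top$ for all $\omega$ imply $G_{ji}(q,\theta_0)=G_{ji}(q,\theta_1)$. **Theorem.** Let $w_i\in\mathcal C$ and $w_j\notin\mathcal C$, and let $x_j\in\mathcal X$ have out-degree one and a known edge to $w_j$. Suppose that for some $\bar{\mathcal X}\subseteq\mathcal X_j\setminus\{x_j\}$ and some $\bar{\mathcal C}\subseteq\mathcal C$ with $w_i\in\bar{\mathcal C}$ there is a $(\mathcal N_i^+\setminus\{w_j\})\cup\bar{\mathcal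 X}\cup\{w_i\}-\bar{\mathcal C}$ disconnecting set $\mathcal D$ such that $$b_{\{w_j\}\cup\mathcal D\to\bar{\mathcal C}}=|\mathcal D|+1\qquad\text{and}\qquad b_{\bar{\mathcal X}\to\mathcal D}=|\mathcal D| .$$ Then $G_{ji}$ is generically identifiable in $\mathcal M$ from $(w_{\mathcal C},r)$. -/

import Mathlib

open Matrix MeasureTheory

namespace DynNet

/-! ## Transfer functions

A (scalar, discrete time) rational transfer operator is a rational function with real coefficients
in the forward shift `z` (written `q` in the time domain), that is, an element of `RatFunc ℝ`. -/

/-- `f` is proper: it has a finite limit as `z → ∞`. -/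
def IsProper (f : RatFunc ℝ) : Prop := f.num.degree ≤ f.denom.degree

/-- `f` is strictly proper: it tends to `0` as `z → ∞`. -/
def IsStrictlyProper (f : RatFunc ℝ) : Prop := f.num.degree < f.denom.degree

/-- `f` is stable: all its poles lie in the open unit disc. -/
def IsStable (f : RatFunc ℝ) : Prop :=
  ∀ z : ℂ, Polynomial.aeval z f.denom = 0 → ‖z‖ < 1

/-- `f` has no pole outside the closed unit disc. -/
def NoPoleOutside (f : RatFunc ℝ) : Prop :=
  ∀ z : ℂ, Polynomial.aeval z f.denom = 0 → ‖z‖ ≤ 1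

/-- The limit of a proper transfer function as `z → ∞` (its direct feedthrough). -/
noncomputable def feedthrough (f : RatFunc ℝ) : ℝ :=
  f.num.coeff f.denom.natDegree / f.denom.leadingCoeff

/-- A square transfer matrix is minimum phase: it is invertible and its inverse has no pole outside
the closed unit disc. -/
def IsMinimumPhase {ι : Type*} [Fintype ι] [DecidableEq ι] (M : Matrix ι ι (RatFunc ℝ)) : Prop :=
  M.det ≠ 0 ∧ ∀ a b, NoPoleOutside (M⁻¹ a b)

/-- The value of a transfer matrix at the complex number `z`. -/
noncomputable def evalAt {ι κ : Type*} (z : ℂ) (M : Matrix ι κ (RatFunc ℝ)) : Matrix ι κ ℂ :=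
  M.map (RatFunc.eval (algebraMap ℝ ℂ) z)

/-- The maximum rank of all matrices with the same nonzero pattern as `M`. -/
noncomputable def structuralRank {ι κ : Type*} [Fintype κ] (M : Matrix ι κ (RatFunc ℝ)) : ℕ :=
  sSup {r | ∃ N : Matrix ι κ (RatFunc ℝ), (∀ a b, N a b = 0 ↔ M a b = 0) ∧ N.rank = r}

/-! ## Directed graphs, paths and disconnecting sets -/

section Graph

variable {V : Type*}

/-- `p` is the vertex list of a directed path that starts in `A` and ends in `B`; no vertex is
repeated, and a single vertex is a path. -/
def IsPathBetween (E : V → V → Prop) (A B : Set V) (p : List V) : Prop :=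
  p.Nodup ∧ p.IsChain E ∧ (∃ a ∈ A, p.head? = some a) ∧ (∃ b ∈ B, p.getLast? = some b)

/-- There are `k` mutually vertex disjoint paths from `A` to `B`. -/
def HasDisjointPaths (E : V → V → Prop) (A B : Set V) (k : ℕ) : Prop :=
  ∃ p : Fin k → List V, (∀ s, IsPathBetween E A B (p s)) ∧
    ∀ s t, s ≠ t → List.Disjoint (p s) (p t)

/-- `b_{A → B}`: the maximum number of mutually vertex disjoint paths from `A` to `B`. -/
noncomputable def maxDisjointPaths (E : V → V → Prop) (A B : Set V) : ℕ :=
  sSup {k | HasDisjointPaths E A B k}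

/-- `D` is an `A - B` disconnecting set: it meets every path from `A` to `B`. -/
def IsDisconnecting (E : V → V → Prop) (A B D : Set V) : Prop :=
  ∀ p : List V, IsPathBetween E A B p → ∃ v ∈ p, v ∈ D

/-- On a finite graph the supremum in `maxDisjointPaths` is a maximum. -/
theorem hasDisjointPaths_bddAbove [Fintype V] (E : V → V → Prop) (A B : Set V) :
    BddAbove {k | HasDisjointPaths E A B k} := by
  refine ⟨Fintype.card V, ?_⟩
  rintro k ⟨p, hp, hd⟩
  choose a _ ha using fun s => (hp s).2.2.1
  have hmem : ∀ s, a s ∈ p s := fun s => List.mem_of_mem_head? (ha s)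
  have hinj : Function.Injective a := by
    intro s t hst
    by_contra hne
    exact hd s t hne (hmem s) (hst ▸ hmem t)
  simpa using Fintype.card_le_of_injective a hinj

end Graph

/-! ## Parameterized network model sets -/

/-- The data of a parameterized set of network models
`w = G(q,θ) w + R r + [H(q,θ); 0] e`, `w_C = C w`, with `L` internal signals, `K` measured
excitation signals `r`, and `n` real parameters.  The noise vector `e` has covariance matrix
`Λ(θ)` and enters the network through a square noise model on the measured signals only.
The values of `G`, `H` and `Λ` matter only for `θ ∈ Θ`. -/
structure NetworkModelSet (L K n : ℕ) where
  /-- the parameter set -/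
  Θ : Set (Fin n → ℝ)
  /-- the measured internal signals -/
  C : Finset (Fin L)
  /-- the matrix of modules; `G θ j i` is the module from `w_i` to `w_j` -/
  G : (Fin n → ℝ) → Matrix (Fin L) (Fin L) (RatFunc ℝ)
  /-- the internal signal that is excited by each component of `r` -/
  exc : Fin K ↪ Fin L
  /-- the noise model on the measured internal signals -/
  H : (Fin n → ℝ) → Matrix C C (RatFunc ℝ)
  /-- the covariance matrix of the white noise -/
  Λ : (Fin n → ℝ) → Matrix C C ℝ

namespace NetworkModelSet

variable {L K n : ℕ} (M : NetworkModelSet L K n)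

/-- External signals: the measured excitations `r` and the noises `e`. -/
abbrev Ext : Type := Fin K ⊕ M.C

/-- Vertices of the graph: internal signals and external signals. -/
abbrev Vert : Type := Fin L ⊕ M.Ext

/-- The binary matrix `R`, consisting of `K` columns of the identity matrix. -/
noncomputable def R : Matrix (Fin L) (Fin K) (RatFunc ℝ) :=
  Matrix.of fun a k => if a = M.exc k then 1 else 0

/-- The noise matrix `[H; 0]` of size `L × |C|`. -/
noncomputable def Hfull (θ : Fin n → ℝ) : Matrix (Fin L) M.C (RatFunc ℝ) :=
  Matrix.of fun a c => if h : a ∈ M.C then M.H θ ⟨a, h⟩ c else 0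

/-- `X = [R  [H; 0]]`. -/
noncomputable def X (θ : Fin n → ℝ) : Matrix (Fin L) M.Ext (RatFunc ℝ) :=
  Matrix.fromCols M.R (M.Hfull θ)

/-- `T = (I - G)⁻¹`. -/
noncomputable def T (θ : Fin n → ℝ) : Matrix (Fin L) (Fin L) (RatFunc ℝ) := (1 - M.G θ)⁻¹

/-- Multiplication by the selection matrix `C` from the left: the rows of the measured signals. -/
def measuredRows {κ S : Type*} (A : Matrix (Fin L) κ S) : Matrix M.C κ S :=
  A.submatrix Subtype.val id

/-- `Φ(ω) = T H Λ H* T*` at `z = exp(i ω)`. -/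
noncomputable def Φ (θ : Fin n → ℝ) (ω : ℝ) : Matrix (Fin L) (Fin L) ℂ :=
  evalAt (Complex.exp (Complex.I * ω)) (M.T θ) *
    evalAt (Complex.exp (Complex.I * ω)) (M.Hfull θ) *
    (M.Λ θ).map (algebraMap ℝ ℂ) *
    (evalAt (Complex.exp (Complex.I * ω)) (M.Hfull θ))ᴴ *
    (evalAt (Complex.exp (Complex.I * ω)) (M.T θ))ᴴ

/-- `C Φ(ω) Cᵀ`, the power spectrum of the measured internal signals. -/
noncomputable def measuredSpectrum (θ : Fin n → ℝ) (ω : ℝ) : Matrix M.C M.C ℂ :=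
  (M.Φ θ ω).submatrix Subtype.val Subtype.val

/-- `G^∞(θ)`, the limit of `G(z,θ)` as `z → ∞`. -/
noncomputable def Ginf (θ : Fin n → ℝ) : Matrix (Fin L) (Fin L) ℝ := (M.G θ).map feedthrough

/-! ### Standing assumptions -/

/-- The regularity of the network model at `θ`. -/
structure IsRegularAt (θ : Fin n → ℝ) : Prop where
  G_proper : ∀ a b, IsProper (M.G θ a b)
  G_stable : ∀ a b, IsStable (M.G θ a b)
  G_hollow : ∀ a, M.G θ a a = 0
  T_stable : ∀ a b, IsStable (M.T θ a b)
  /-- well-posedness: all principal minors of `lim (I - G(z))` are nonzero -/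
  wellPosed : ∀ S : Finset (Fin L),
    ((1 - M.Ginf θ).submatrix (Subtype.val : S → Fin L) (Subtype.val : S → Fin L)).det ≠ 0
  H_proper : ∀ a b, IsProper (M.H θ a b)
  H_stable : ∀ a b, IsStable (M.H θ a b)
  Λ_posSemidef : (M.Λ θ).PosSemidef

/-- The noise model at `θ` is monic and minimum phase. -/
def IsMonicMinimumPhaseAt (θ : Fin n → ℝ) : Prop :=
  (M.H θ).map feedthrough = 1 ∧ IsMinimumPhase (M.H θ)

/-- The transfer matrix `C T [H; 0]` from the noise to the measured signals is minimum phase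
at `θ`. -/
def IsNoiseResponseMinimumPhaseAt (θ : Fin n → ℝ) : Prop :=
  IsMinimumPhase (M.measuredRows (M.T θ * M.Hfull θ))

/-- The power spectrum of the measured signals has full rank at almost all frequencies. -/
def HasFullRankSpectrum : Prop :=
  ∀ θ ∈ M.Θ, ∀ᵐ ω : ℝ, (M.measuredSpectrum θ ω).rank = M.C.card

/-- The value at `θ` of a polynomial in `z` whose coefficients are polynomials in the
parameters. -/
noncomputable def specialize (θ : Fin n → ℝ) (p : Polynomial (MvPolynomial (Fin n) ℝ)) :
    Polynomial ℝ :=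
  p.map (MvPolynomial.eval θ)

/-- On `Θ`, the transfer function `f(q,θ)` is a quotient of two polynomials in `z` whose
coefficients are polynomials in those parameters that are indexed by `S`. -/
def IsRationalIn (Θ : Set (Fin n → ℝ)) (S : Set (Fin n)) (f : (Fin n → ℝ) → RatFunc ℝ) : Prop :=
  ∃ p q : Polynomial (MvPolynomial (Fin n) ℝ),
    (∀ k, p.coeff k ∈ MvPolynomial.supported ℝ S) ∧
    (∀ k, q.coeff k ∈ MvPolynomial.supported ℝ S) ∧
    ∀ θ ∈ Θ, specialize θ q ≠ 0 ∧
      f θ = algebraMap (Polynomial ℝ) (RatFunc ℝ) (specialize θ p) /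
        algebraMap (Polynomial ℝ) (RatFunc ℝ) (specialize θ q)

/-- The entries of `G` and `H` are rationally and independently parameterized: every parameter is
assigned to one entry, and every entry is a rational expression in its own parameters. -/
def IsIndependentlyParameterized : Prop :=
  ∃ owner : Fin n → (Fin L × Fin L) ⊕ (M.C × M.C),
    (∀ a b, IsRationalIn M.Θ {k | owner k = Sum.inl (a, b)} fun θ => M.G θ a b) ∧
    (∀ a b, IsRationalIn M.Θ {k | owner k = Sum.inr (a, b)} fun θ => M.H θ a b)

/-- Either all modules are strictly proper, or the noise covariance is diagonal and there are no
algebraic loops: one simultaneous reordering of the internal signals makes `G^∞(θ)` lower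
triangular for all `θ`. -/
def HasFeedthroughCondition : Prop :=
  (∀ θ ∈ M.Θ, ∀ a b, IsStrictlyProper (M.G θ a b)) ∨
  ((∀ θ ∈ M.Θ, (M.Λ θ).IsDiag) ∧
    ∃ σ : Equiv.Perm (Fin L), ∀ θ ∈ M.Θ, ∀ a b, σ a < σ b → M.Ginf θ a b = 0)

/-- A parameter dependent entry is known (fixed) if it does not depend on `θ ∈ Θ`. -/
def IsKnown (f : (Fin n → ℝ) → RatFunc ℝ) : Prop :=
  ∀ θ ∈ M.Θ, ∀ θ' ∈ M.Θ, f θ = f θ'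

/-- The matrix `[(G - I)  X]`; its rows are the internal signals and its columns the vertices. -/
noncomputable def systemMatrix (θ : Fin n → ℝ) : Matrix (Fin L) M.Vert (RatFunc ℝ) :=
  Matrix.fromCols (M.G θ - 1) (M.X θ)

/-- Every submatrix of `[(G - I)  X]` that does not depend on `θ` has rank equal to its structural
rank. -/
def HasRegularFixedEntries : Prop :=
  ∀ (I : Finset (Fin L)) (J : Finset M.Vert),
    (∀ a ∈ I, ∀ v ∈ J, M.IsKnown fun θ => M.systemMatrix θ a v) →
    ∀ θ ∈ M.Θ,
      ((M.systemMatrix θ).submatrix (Subtype.val : I → Fin L) (Subtype.val : J → M.Vert)).rank =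
      structuralRank
        ((M.systemMatrix θ).submatrix (Subtype.val : I → Fin L) (Subtype.val : J → M.Vert))

/-! ### The graph of the model set -/

/-- The transfer function of the (potential) edge from the vertex `v` to the internal signal `a`:
an entry of `G`, `R` or `[H; 0]`. -/
noncomputable def entry (v : M.Vert) (a : Fin L) (θ : Fin n → ℝ) : RatFunc ℝ :=
  Matrix.fromCols (M.G θ) (M.X θ) a v

/-- There is an edge from `v` to `w_a`: the entry is not fixed to zero. -/
def HasEdgeTo (v : M.Vert) (a : Fin L) : Prop := ∃ θ ∈ M.Θ, M.entry v a θ ≠ 0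

/-- There is an edge from `v` to `w_a`, and it is known. -/
def HasKnownEdgeTo (v : M.Vert) (a : Fin L) : Prop :=
  M.HasEdgeTo v a ∧ M.IsKnown (M.entry v a)

/-- There is an edge from `v` to `w_a`, and it is unknown. -/
def HasUnknownEdgeTo (v : M.Vert) (a : Fin L) : Prop :=
  M.HasEdgeTo v a ∧ ¬ M.IsKnown (M.entry v a)

/-- The edge relation of the directed graph; external signals have no incoming edges. -/
def Edge (v u : M.Vert) : Prop := ∃ a : Fin L, u = Sum.inl a ∧ M.HasEdgeTo v a

/-- The out-degree of a vertex. -/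
noncomputable def outDegree (v : M.Vert) : ℕ := {u | M.Edge v u}.ncard

/-- `𝒳_j`: the external signals that have no unknown edge to `w_j`. -/
def XSet (j : Fin L) : Set M.Ext := {x | ¬ M.HasUnknownEdgeTo (Sum.inr x) j}

/-- `𝒩_i⁺`: the out-neighbors of `w_i`, except those to which `w_i` has a known edge and which are
excited by an external signal of out-degree one through a known edge. -/
def NPlus (i : Fin L) : Set (Fin L) :=
  {a | M.HasEdgeTo (Sum.inl i) a ∧
    ¬ (M.HasKnownEdgeTo (Sum.inl i) a ∧
      ∃ x : M.Ext, M.outDegree (Sum.inr x) = 1 ∧ M.HasKnownEdgeTo (Sum.inr x) a)}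

/-! ### Generic identifiability -/

/-- The module `G_{ji}` is generically identifiable from `(w_C, r)`: for all `θ₀ ∈ Θ` outside a
Lebesgue null set, `C T R` and the power spectrum `C Φ Cᵀ` at `θ₀` determine `G_{ji}` within the
model set. -/
def IsGenericallyIdentifiable (j i : Fin L) : Prop :=
  ∀ᵐ θ₀ : Fin n → ℝ, θ₀ ∈ M.Θ → ∀ θ₁ ∈ M.Θ,
    M.measuredRows (M.T θ₀ * M.R) = M.measuredRows (M.T θ₁ * M.R) →
    (∀ ω : ℝ, M.measuredSpectrum θ₀ ω = M.measuredSpectrum θ₁ ω) →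
    M.G θ₀ j i = M.G θ₁ j i

end NetworkModelSet

end DynNet

/-! The data determine the responses `T X` of the measured signals to all external signals. For `r`
this is given. For the noise, two stable, minimum phase spectral factors that are invertible at
infinity differ by a constant real matrix `Q` (`exists_eq_mul_map_C_of_spectrum_eq`): once square
roots of the covariances are absorbed, their quotient is unitary on the unit circle and cannot have
poles anywhere. The feedthrough condition forces `Q = 1` (`noiseResponse_eq`).

Let `B` be the set of vertices from which `C̄` can be reached while avoiding `D`. Whatever
originates outside `B` reaches `C̄` only through `D`. Hence the signals that obey the network
equations inside `B`, with no external input there, have measured parts in a space of dimension at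
most `|D|` (`finrank_localResponses_le`). This space contains the columns of `T`, restricted to
`C̄`, that belong to `w_i` and to `𝒩_i⁺ ∖ {w_j}`, and the responses to `X̄`. The two path conditions
link `X' ∪ {x_j}` disjointly into `C̄` for some `X' ⊆ X̄` with `|X'| = |D|` (`exists_linking`), so
generically the responses to `X' ∪ {x_j}` are linearly independent. The span `S` of the responses to
`X'` therefore fills the local space of both models. Subtracting column `i` of `T (I - G) = I` for
the two models shows that `(G_{ji}(θ₀) - G_{ji}(θ₁)) T_j` lies in `S`. Since `T_j` is a nonzero
multiple of the response to `x_j`, which is not in `S`, the difference vanishes.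

For the generic independence, the linking is encoded by an injective choice of one column of `[G - I
X]` per row, with entries on the resulting diagonal that are not identically zero. Known entries
cannot be varied, so a nonzero diagonal alone is not enough. `exists_det_ne_zero_of_blockKernel`, a
theorem on mixed matrices, reduces nonsingularity to rank bounds for the fixed blocks, and the
assumption on structural ranks supplies these bounds. -/

namespace DynNet

/-! ### Mixed matrices -/

section MixedMatrix

variable {F ι κ : Type*} [Field F] [Fintype κ]

/-- The vectors supported on `J` that are annihilated by the rows `I` of `A`. -/
def blockKernel (A : Matrix ι κ F) (I : Finset ι) (J : Finset κ) : Submodule F (κ → F) where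
  carrier := {x | (∀ b ∉ J, x b = 0) ∧ ∀ a ∈ I, (A *ᵥ x) a = 0}
  add_mem' := by
    rintro x y ⟨hx, hx'⟩ ⟨hy, hy'⟩
    refine ⟨fun b hb => by simp [hx b hb, hy b hb], fun a ha => ?_⟩
    simp [Matrix.mulVec_add, hx' a ha, hy' a ha]
  zero_mem' := by simp
  smul_mem' := by
    rintro c x ⟨hx, hx'⟩
    refine ⟨fun b hb => by simp [hx b hb], fun a ha => ?_⟩
    simp [Matrix.mulVec_smul, hx' a ha]

theorem mem_blockKernel {A : Matrix ι κ F} {I : Finset ι} {J : Finset κ} {x : κ → F} :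
    x ∈ blockKernel A I J ↔ (∀ b ∉ J, x b = 0) ∧ ∀ a ∈ I, (A *ᵥ x) a = 0 := Iff.rfl

theorem blockKernel_congr {A B : Matrix ι κ F} {I : Finset ι} {J : Finset κ}
    (h : ∀ a ∈ I, ∀ b ∈ J, A a b = B a b) : blockKernel A I J = blockKernel B I J := by
  ext x
  simp only [mem_blockKernel]
  refine and_congr_right fun hx => forall₂_congr fun a ha => ?_
  have : (A *ᵥ x) a = (B *ᵥ x) a := by
    refine Finset.sum_congr rfl fun b _ => ?_
    by_cases hb : b ∈ J
    · simp only [h a ha b hb]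
    · simp [hx b hb]
  rw [this]

/-- Rank-nullity for the block. It turns rank bounds into bounds on subspaces of one common space,
where sums and intersections of kernels of different blocks make sense. -/
theorem finrank_blockKernel_add_rank (A : Matrix ι κ F) (I : Finset ι) (J : Finset κ) :
    Module.finrank F (blockKernel A I J) +
      (A.submatrix (Subtype.val : I → ι) (Subtype.val : J → κ)).rank = J.card := by
  classical
  have key : ∀ x : κ → F, (∀ b ∉ J, x b = 0) → ∀ a : I,
      ((A.submatrix (Subtype.val : I → ι) (Subtype.val : J → κ)) *ᵥ fun b : J => x b) a =
        (A *ᵥ x) a := by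
    intro x hx a
    simp only [Matrix.mulVec, dotProduct, Matrix.submatrix_apply]
    rw [Finset.sum_coe_sort J (fun b => A a b * x b)]
    exact Finset.sum_subset (Finset.subset_univ _) fun b _ hb => by simp [hx b hb]
  let e : blockKernel A I J ≃ₗ[F]
      LinearMap.ker (A.submatrix (Subtype.val : I → ι) (Subtype.val : J → κ)).mulVecLin :=
    { toFun := fun x => ⟨fun b => x.1 b, by
        ext a
        simpa [key x.1 x.2.1 a] using x.2.2 a a.2⟩
      map_add' := fun _ _ => rfl
      map_smul' := fun _ _ => rfl
      invFun := fun y => ⟨fun b => if h : b ∈ J then y.1 ⟨b, h⟩ else 0, by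
        have h0 : ∀ b ∉ J, (fun b => if h : b ∈ J then y.1 ⟨b, h⟩ else 0) b = 0 :=
          fun b hb => by simp [hb]
        refine ⟨h0, fun a ha => ?_⟩
        rw [← key _ h0 ⟨a, ha⟩]
        rw [show (fun b : J => if h : b.1 ∈ J then y.1 ⟨b, h⟩ else 0) = y.1 by ext b; simp]
        exact congrFun (LinearMap.mem_ker.1 y.2) ⟨a, ha⟩⟩
      left_inv := fun x => by
        ext b
        by_cases hb : b ∈ J
        · simp [hb]
        · simp [hb, x.2.1 b hb]
      right_inv := fun y => by ext b; simp }
  rw [e.finrank_eq, Matrix.rank, add_comm, LinearMap.finrank_range_add_finrank_ker]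
  simp

theorem finrank_le_finrank_inf_ker_add_one {V : Type*} [AddCommGroup V] [Module F V]
    [FiniteDimensional F V] (S : Submodule F V) (f : V →ₗ[F] F) :
    Module.finrank F S ≤ Module.finrank F (S ⊓ LinearMap.ker f : Submodule F V) + 1 := by
  have h1 := LinearMap.finrank_range_add_finrank_ker (f.domRestrict S)
  have h2 : Module.finrank F (LinearMap.range (f.domRestrict S)) ≤ 1 := by
    simpa using Submodule.finrank_le (LinearMap.range (f.domRestrict S))
  have h3 : Module.finrank F (LinearMap.ker (f.domRestrict S)) =
      Module.finrank F (S ⊓ LinearMap.ker f : Submodule F V) := by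
    rw [LinearMap.ker_domRestrict, ← Submodule.finrank_map_subtype_eq,
      Submodule.map_comap_subtype]
  omega

variable [DecidableEq ι]

/-- Submodularity of the rank of blocks, in terms of the kernels of blocks. -/
theorem finrank_blockKernel_submodular [DecidableEq κ] (A : Matrix ι κ F) (I₁ I₂ : Finset ι)
    (J₁ J₂ : Finset κ) :
    Module.finrank F (blockKernel A I₁ J₁) + Module.finrank F (blockKernel A I₂ J₂) ≤
      Module.finrank F (blockKernel A (I₁ ∩ I₂) (J₁ ∪ J₂)) +
        Module.finrank F (blockKernel A (I₁ ∪ I₂) (J₁ ∩ J₂)) := by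
  -- By the dimension formula it is enough that the sum of the two kernels lies in the first kernel
  -- on the right and their intersection in the second.
  rw [← Submodule.finrank_sup_add_finrank_inf_eq]
  refine add_le_add (Submodule.finrank_mono (sup_le ?_ ?_)) (Submodule.finrank_mono ?_)
  · rintro x ⟨hx, hx'⟩
    exact ⟨fun b hb => hx b (by simp_all), fun a ha => hx' a (by simp_all)⟩
  · rintro x ⟨hx, hx'⟩
    exact ⟨fun b hb => hx b (by simp_all), fun a ha => hx' a (by simp_all)⟩
  · rintro x ⟨⟨hx, hx'⟩, hy, hy'⟩
    refine ⟨fun b hb => ?_, fun a ha => ?_⟩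
    · by_cases h : b ∈ J₁
      · exact hy b fun h2 => hb (Finset.mem_inter.2 ⟨h, h2⟩)
      · exact hx b h
    · rcases Finset.mem_union.1 ha with h | h
      · exact hx' a h
      · exact hy' a h

variable [Fintype ι]

/-- The determinant is affine in a single entry, with the cofactor as slope. The cofactor is written
with a unit row so that it stays the determinant of a matrix of the same size. -/
theorem det_updateRow_update (A : Matrix ι ι F) (a b : ι) (v : ι → F) (x : F) :
    (A.updateRow a (Function.update v b x)).det =
      (A.updateRow a (Function.update v b 0)).det +
        x * (A.updateRow a (Pi.single b 1)).det := by
  rw [← Matrix.det_updateRow_smul, ← Matrix.det_updateRow_add]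
  congr 2
  ext c
  by_cases h : c = b
  · subst h; simp
  · simp [h]

/-- A matrix whose entries can be chosen independently from two values each can be made
nonsingular if all its blocks without a choice have rank at least `|I| + |J| - n`. -/
theorem exists_det_ne_zero_of_blockKernel (A B : Matrix ι ι F)
    (h : ∀ I J : Finset ι, (∀ a ∈ I, ∀ b ∈ J, A a b = B a b) →
      Module.finrank F (blockKernel A I J) + I.card ≤ Fintype.card ι) :
    ∃ M : Matrix ι ι F, (∀ a b, M a b = A a b ∨ M a b = B a b) ∧ M.det ≠ 0 := by
  classical
  induction hN : (Finset.univ.filter fun p : ι × ι => A p.1 p.2 ≠ B p.1 p.2).card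
    using Nat.strong_induction_on generalizing A B with
  | _ N ih =>
  subst hN
  by_cases hAB : ∀ a b, A a b = B a b
  · refine ⟨A, fun a b => Or.inl rfl, ?_⟩
    have h0 := h Finset.univ Finset.univ fun a _ b _ => hAB a b
    have h1 : blockKernel A Finset.univ Finset.univ = ⊥ := by
      rw [← Submodule.finrank_eq_zero (R := F)]
      simp only [Finset.card_univ] at h0
      omega
    intro hdet
    obtain ⟨v, hv, hv'⟩ := Matrix.exists_mulVec_eq_zero_iff.2 hdet
    have : v ∈ blockKernel A Finset.univ Finset.univ := ⟨by simp, by simp [hv']⟩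
    rw [h1] at this
    exact hv (by simpa using this)
  push Not at hAB
  obtain ⟨a, b, hab⟩ := hAB
  -- the reduction of the number of free entries
  have hlt : ∀ A' B' : Matrix ι ι F, A' a b = B' a b →
      (∀ c d, A c d = B c d → A' c d = B' c d) →
      (Finset.univ.filter fun p : ι × ι => A' p.1 p.2 ≠ B' p.1 p.2).card <
        (Finset.univ.filter fun p : ι × ι => A p.1 p.2 ≠ B p.1 p.2).card := by
    intro A' B' h1 h2
    refine Finset.card_lt_card ⟨fun p hp => ?_, fun hsub => ?_⟩
    · simp only [Finset.mem_filter, Finset.mem_univ, true_and] at hp ⊢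
      exact fun he => hp (h2 _ _ he)
    · have := @hsub (a, b) (by simp [hab])
      simp [h1] at this
  -- The two reduced problems stand for the slope and the constant term of the determinant as an
  -- affine function of the entry `(a, b)`. If either is nonzero, that function cannot vanish at
  -- both of the distinct values `A a b` and `B a b`.
  set A₁ := A.updateRow a (Pi.single b 1) with hA₁
  set B₁ := B.updateRow a (Pi.single b 1) with hB₁
  set A₂ := A.updateRow a (Function.update (A a) b 0) with hA₂
  set B₂ := B.updateRow a (Function.update (B a) b 0) with hB₂
  -- it suffices to find a nonsingular choice for one of the two reduced problems
  have hfin : ∀ M : Matrix ι ι F, (∀ c d, c ≠ a → M c d = A c d ∨ M c d = B c d) →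
      ∀ v : ι → F, (∀ d, d ≠ b → v d = A a d ∨ v d = B a d) →
      ((M.updateRow a (Function.update v b 0)).det ≠ 0 ∨
        (M.updateRow a (Pi.single b 1)).det ≠ 0) →
      ∃ M : Matrix ι ι F, (∀ a b, M a b = A a b ∨ M a b = B a b) ∧ M.det ≠ 0 := by
    intro M hM v hv hdet
    have hchoice : ∀ x, (x = A a b ∨ x = B a b) → ∀ c d,
        M.updateRow a (Function.update v b x) c d = A c d ∨
          M.updateRow a (Function.update v b x) c d = B c d := by
      intro x hx c d
      by_cases hc : c = a
      · subst hc
        by_cases hd : d = b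
        · subst hd; simpa using hx
        · simpa [hd] using hv d hd
      · simpa [hc] using hM c d hc
    by_contra hcon
    push Not at hcon
    have e1 := hcon _ (hchoice _ (Or.inl rfl))
    have e2 := hcon _ (hchoice _ (Or.inr rfl))
    rw [det_updateRow_update] at e1 e2
    have e3 : (A a b - B a b) * (M.updateRow a (Pi.single b 1)).det = 0 := by
      linear_combination e1 - e2
    have e4 := (mul_eq_zero.1 e3).resolve_left (sub_ne_zero.2 hab)
    rw [e4] at e1
    rcases hdet with h' | h'
    · exact h' (by simpa using e1)
    · exact h' e4
  by_cases h1 : ∀ I J : Finset ι, (∀ a ∈ I, ∀ b ∈ J, A₁ a b = B₁ a b) →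
      Module.finrank F (blockKernel A₁ I J) + I.card ≤ Fintype.card ι
  · obtain ⟨M, hM, hdet⟩ := ih _ (hlt A₁ B₁ (by simp [hA₁, hB₁]) (by
      intro c d hcd
      by_cases hc : c = a
      · subst hc; simp [hA₁, hB₁]
      · simp [hA₁, hB₁, hc, hcd])) A₁ B₁ h1 rfl
    refine hfin M (fun c d hc => by simpa [hA₁, hB₁, hc] using hM c d) (A a)
      (fun d _ => Or.inl rfl) (Or.inr ?_)
    have : M.updateRow a (Pi.single b 1) = M := by
      ext c d
      by_cases hc : c = a
      · subst hc
        have := hM c d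
        simp only [hA₁, hB₁, Matrix.updateRow_self, or_self] at this
        simp [this]
      · simp [hc]
    rwa [this]
  by_cases h2 : ∀ I J : Finset ι, (∀ a ∈ I, ∀ b ∈ J, A₂ a b = B₂ a b) →
      Module.finrank F (blockKernel A₂ I J) + I.card ≤ Fintype.card ι
  · obtain ⟨M, hM, hdet⟩ := ih _ (hlt A₂ B₂ (by simp [hA₂, hB₂]) (by
      intro c d hcd
      by_cases hc : c = a
      · subst hc
        by_cases hd : d = b
        · subst hd; simp [hA₂, hB₂]
        · simp [hA₂, hB₂, hd, hcd]
      · simp [hA₂, hB₂, hc, hcd])) A₂ B₂ h2 rfl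
    refine hfin M (fun c d hc => by simpa [hA₂, hB₂, hc] using hM c d) (M a)
      (fun d hd => by simpa [hA₂, hB₂, hd] using hM a d) (Or.inl ?_)
    have : M.updateRow a (Function.update (M a) b 0) = M := by
      ext c d
      by_cases hc : c = a
      · subst hc
        by_cases hd : d = b
        · subst hd
          have := hM c d
          simp only [hA₂, hB₂, Matrix.updateRow_self, Function.update_self, or_self] at this
          simp [this]
        · simp [hd]
      · simp [hc]
    rwa [this]
  -- If both reduced problems fail, each has a violating block. These are uncrossed into two blocks
  -- of the original problem that cannot both satisfy the hypothesis.
  exfalso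
  push Not at h1 h2
  obtain ⟨I₁, J₁, hk₁, hr₁⟩ := h1
  obtain ⟨I₂, J₂, hk₂, hr₂⟩ := h2
  -- the block `(I₂, J₂)` contains the free entry
  have hmem : a ∈ I₂ ∧ b ∈ J₂ := by
    by_contra hcon
    have hne : ∀ c ∈ I₂, ∀ d ∈ J₂, ¬ (c = a ∧ d = b) := by
      rintro c hc d hd ⟨rfl, rfl⟩
      exact hcon ⟨hc, hd⟩
    have e : ∀ (M : Matrix ι ι F), ∀ c ∈ I₂, ∀ d ∈ J₂,
        M.updateRow a (Function.update (M a) b 0) c d = M c d := by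
      intro M c hc d hd
      by_cases hca : c = a
      · subst hca
        have : d ≠ b := fun hdb => hne c hc d hd ⟨rfl, hdb⟩
        simp [this]
      · simp [hca]
    have := h I₂ J₂ fun c hc d hd => by
      rw [← e A c hc d hd, ← e B c hc d hd]; exact hk₂ c hc d hd
    have e' : blockKernel A₂ I₂ J₂ = blockKernel A I₂ J₂ := blockKernel_congr (e A)
    rw [e'] at hr₂
    omega
  have hA₁A : ∀ M : Matrix ι ι F, ∀ c ∈ I₁.erase a, ∀ d ∈ J₁.erase b,
      M.updateRow a (Pi.single b 1) c d = M c d := by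
    intro M c hc d _
    simp [(Finset.mem_erase.1 hc).1]
  -- Removing row `a` and column `b` costs at most one in the violated inequality. If `a ∈ I₁`, the
  -- unit row already forces `x b = 0` and only `|I₁|` drops. Otherwise imposing `x b = 0` lowers
  -- the dimension by at most one.
  have hr₁' : Fintype.card ι ≤
      Module.finrank F (blockKernel A₁ (I₁.erase a) (J₁.erase b)) + (I₁.erase a).card := by
    by_cases ha : a ∈ I₁
    · have hle : blockKernel A₁ I₁ J₁ ≤ blockKernel A₁ (I₁.erase a) (J₁.erase b) := by
        rintro x ⟨hx, hx'⟩
        refine ⟨fun d hd => ?_, fun c hc => hx' c (Finset.mem_of_mem_erase hc)⟩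
        by_cases hdb : d = b
        · have := hx' a ha
          subst hdb
          simpa [hA₁, Matrix.mulVec] using this
        · exact hx d fun h => hd (Finset.mem_erase.2 ⟨hdb, h⟩)
      have := Submodule.finrank_mono hle
      rw [Finset.card_erase_of_mem ha]
      omega
    · have hle : blockKernel A₁ I₁ J₁ ⊓ LinearMap.ker (LinearMap.proj b : (ι → F) →ₗ[F] F) ≤
          blockKernel A₁ (I₁.erase a) (J₁.erase b) := by
        rintro x ⟨⟨hx, hx'⟩, hxb⟩
        refine ⟨fun d hd => ?_, fun c hc => hx' c (Finset.mem_of_mem_erase hc)⟩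
        by_cases hdb : d = b
        · subst hdb; simpa using hxb
        · exact hx d fun h => hd (Finset.mem_erase.2 ⟨hdb, h⟩)
      have := Submodule.finrank_mono hle
      have := finrank_le_finrank_inf_ker_add_one (blockKernel A₁ I₁ J₁)
        (LinearMap.proj b : (ι → F) →ₗ[F] F)
      rw [Finset.erase_eq_of_notMem ha] at *
      omega
  set I₃ := I₁.erase a
  set J₃ := J₁.erase b
  have haI : a ∉ I₃ := Finset.notMem_erase _ _
  have hbJ : b ∉ J₃ := Finset.notMem_erase _ _
  have hk₃ : ∀ c ∈ I₃, ∀ d ∈ J₃, A c d = B c d := fun c hc d hd => by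
    rw [← hA₁A A c hc d hd, ← hA₁A B c hc d hd]
    exact hk₁ c (Finset.mem_of_mem_erase hc) d (Finset.mem_of_mem_erase hd)
  have hA₂A : ∀ M : Matrix ι ι F, ∀ c d, ¬ (c = a ∧ d = b) →
      M.updateRow a (Function.update (M a) b 0) c d = M c d := by
    intro M c d hcd
    by_cases hc : c = a
    · subst hc
      have : d ≠ b := fun hdb => hcd ⟨rfl, hdb⟩
      simp [this]
    · simp [hc]
  have hk₂' : ∀ c ∈ I₂, ∀ d ∈ J₂, ¬ (c = a ∧ d = b) → A c d = B c d := by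
    intro c hc d hd hcd
    rw [← hA₂A A c d hcd, ← hA₂A B c d hcd]
    exact hk₂ c hc d hd
  have e3 : blockKernel A₁ I₃ J₃ = blockKernel A₂ I₃ J₃ := by
    refine blockKernel_congr fun c hc d hd => ?_
    rw [hA₁, hA₁A A c hc d hd, hA₂, hA₂A A c d]
    rintro ⟨rfl, -⟩; exact haI hc
  -- Neither uncrossed block contains `(a, b)`: `a` is missing from `I₃ ∩ I₂` and `b` from `J₃ ∩
  -- J₂`. The hypothesis bounds their total by twice the size, whereas `hr₁'` and the strict `hr₂`
  -- make it larger.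
  have hsub := finrank_blockKernel_submodular A₂ I₃ I₂ J₃ J₂
  have hcap := h (I₃ ∩ I₂) (J₃ ∪ J₂) (by
    intro c hc d hd
    rw [Finset.mem_inter] at hc
    rcases Finset.mem_union.1 hd with hd | hd
    · exact hk₃ c hc.1 d hd
    · exact hk₂' c hc.2 d hd (by rintro ⟨rfl, -⟩; exact haI hc.1))
  have hcup := h (I₃ ∪ I₂) (J₃ ∩ J₂) (by
    intro c hc d hd
    rw [Finset.mem_inter] at hd
    rcases Finset.mem_union.1 hc with hc | hc
    · exact hk₃ c hc d hd.1
    · exact hk₂' c hc d hd.2 (by rintro ⟨-, rfl⟩; exact hbJ hd.1))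
  rw [← blockKernel_congr (A := A₂) (by
    intro c hc d hd
    exact hA₂A A c d (by rintro ⟨rfl, -⟩; exact haI (Finset.mem_inter.1 hc).1))] at hcap
  rw [← blockKernel_congr (A := A₂) (by
    intro c hc d hd
    exact hA₂A A c d (by rintro ⟨-, rfl⟩; exact hbJ (Finset.mem_inter.1 hd).1))] at hcup
  have hcard := Finset.card_inter_add_card_union I₃ I₂
  rw [e3] at hr₁'
  omega

end MixedMatrix

/-! ### Vertex disjoint paths -/

section Linking

variable {V : Type*}

/-- `u` and `v` are consecutive in the list `p`. -/
def Consecutive (p : List V) (u v : V) : Prop :=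
  ∃ k, p[k]? = some u ∧ p[k + 1]? = some v

theorem Consecutive.left_mem {p : List V} {u v : V} (h : Consecutive p u v) : u ∈ p :=
  let ⟨_, h, _⟩ := h
  List.mem_of_getElem? h

theorem Consecutive.right_mem {p : List V} {u v : V} (h : Consecutive p u v) : v ∈ p :=
  let ⟨_, _, h⟩ := h
  List.mem_of_getElem? h

theorem index_unique {p : List V} (hp : p.Nodup) {k l : ℕ} {u : V} (hk : p[k]? = some u)
    (hl : p[l]? = some u) : k = l := by
  obtain ⟨h1, h2⟩ := List.getElem?_eq_some_iff.1 hk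
  obtain ⟨h3, h4⟩ := List.getElem?_eq_some_iff.1 hl
  exact (hp.getElem_inj_iff).1 (h2.trans h4.symm)

theorem Consecutive.right_unique {p : List V} (hp : p.Nodup) {u v v' : V}
    (h : Consecutive p u v) (h' : Consecutive p u v') : v = v' := by
  obtain ⟨k, h1, h2⟩ := h
  obtain ⟨l, h3, h4⟩ := h'
  obtain rfl := index_unique hp h1 h3
  exact Option.some.inj (h2.symm.trans h4)

theorem Consecutive.left_unique {p : List V} (hp : p.Nodup) {u u' v : V}
    (h : Consecutive p u v) (h' : Consecutive p u' v) : u = u' := by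
  obtain ⟨k, h1, h2⟩ := h
  obtain ⟨l, h3, h4⟩ := h'
  obtain rfl := Nat.succ_injective (index_unique hp h2 h4)
  exact Option.some.inj (h1.symm.trans h3)

theorem Consecutive.getLast?_ne {p : List V} (hp : p.Nodup) {u v : V} (h : Consecutive p u v) :
    p.getLast? ≠ some u := by
  obtain ⟨k, h1, h2⟩ := h
  intro h3
  rw [List.getLast?_eq_getElem?] at h3
  have := index_unique hp h1 h3
  obtain ⟨h4, -⟩ := List.getElem?_eq_some_iff.1 h2
  omega

theorem Consecutive.head?_ne {p : List V} (hp : p.Nodup) {u v : V} (h : Consecutive p u v) :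
    p.head? ≠ some v := by
  obtain ⟨k, h1, h2⟩ := h
  intro h3
  rw [List.head?_eq_getElem?] at h3
  have := index_unique hp h2 h3
  omega

theorem Consecutive.rel {E : V → V → Prop} {p : List V} (hp : p.IsChain E) {u v : V}
    (h : Consecutive p u v) : E u v := by
  obtain ⟨k, h1, h2⟩ := h
  obtain ⟨h3, rfl⟩ := List.getElem?_eq_some_iff.1 h1
  obtain ⟨h4, rfl⟩ := List.getElem?_eq_some_iff.1 h2
  exact List.isChain_iff_getElem.1 hp k h4

theorem head?_or_consecutive {p : List V} {v : V} (hv : v ∈ p) :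
    p.head? = some v ∨ ∃ u, Consecutive p u v := by
  obtain ⟨k, hk⟩ := List.mem_iff_getElem?.1 hv
  cases k with
  | zero => left; rwa [List.head?_eq_getElem?]
  | succ k =>
    right
    obtain ⟨h1, -⟩ := List.getElem?_eq_some_iff.1 hk
    exact ⟨p[k], k, List.getElem?_eq_getElem (by omega), hk⟩

theorem getLast?_or_consecutive {p : List V} {v : V} (hv : v ∈ p) :
    p.getLast? = some v ∨ ∃ u, Consecutive p v u := by
  obtain ⟨k, hk⟩ := List.mem_iff_getElem?.1 hv
  obtain ⟨h1, -⟩ := List.getElem?_eq_some_iff.1 hk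
  by_cases h : k + 1 < p.length
  · exact Or.inr ⟨p[k + 1], k, hk, List.getElem?_eq_getElem h⟩
  · left
    rw [List.getLast?_eq_getElem?, ← hk]
    congr 1
    omega

/-- The vertices from which `B` can be reached along a path that avoids `D`. -/
def reachAvoiding (E : V → V → Prop) (B D : Set V) : Set V :=
  {v | ∃ p, IsPathBetween E {v} B p ∧ ∀ u ∈ p, u ∉ D}

variable {E : V → V → Prop} {A B D : Set V}

theorem mem_reachAvoiding_of_mem {v : V} (hB : v ∈ B) (hD : v ∉ D) : v ∈ reachAvoiding E B D :=
  ⟨[v], ⟨by simp, by simp, ⟨v, rfl, rfl⟩, ⟨v, hB, rfl⟩⟩, by simpa using hD⟩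

theorem IsDisconnecting.notMem_reachAvoiding (h : IsDisconnecting E A B D) {v : V} (hv : v ∈ A) :
    v ∉ reachAvoiding E B D := by
  rintro ⟨p, ⟨h1, h2, ⟨a, rfl, ha⟩, h4⟩, hp⟩
  obtain ⟨u, hu, hu'⟩ := h p ⟨h1, h2, ⟨a, hv, ha⟩, h4⟩
  exact hp u hu hu'

theorem mem_reachAvoiding_of_suffix {p : List V} (hn : p.Nodup) (hc : p.IsChain E)
    (hl : ∃ b ∈ B, p.getLast? = some b) {k : ℕ} {v : V} (hv : p[k]? = some v)
    (hD : ∀ l u, k ≤ l → p[l]? = some u → u ∉ D) : v ∈ reachAvoiding E B D := by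
  obtain ⟨hk, -⟩ := List.getElem?_eq_some_iff.1 hv
  refine ⟨p.drop k, ⟨hn.sublist (List.drop_sublist _ _), hc.suffix (List.drop_suffix _ _),
    ⟨v, rfl, by simpa using hv⟩, ?_⟩, fun u hu => ?_⟩
  · obtain ⟨b, hb, hb'⟩ := hl
    exact ⟨b, hb, by rw [List.getLast?_drop, if_neg (by omega), hb']⟩
  · obtain ⟨l, hl⟩ := List.mem_iff_getElem?.1 hu
    rw [List.getElem?_drop] at hl
    exact hD _ u (by omega) hl

/-- Prepending `u` could repeat a vertex. If `u` is already on the path, the suffix that starts at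
`u` is used instead. -/
theorem mem_reachAvoiding_of_rel {u v : V} (h : E u v) (hu : u ∉ D)
    (hv : v ∈ reachAvoiding E B D) : u ∈ reachAvoiding E B D := by
  obtain ⟨p, ⟨h1, h2, ⟨a, rfl, ha⟩, h4⟩, hp⟩ := hv
  by_cases hup : u ∈ p
  · obtain ⟨k, hk⟩ := List.mem_iff_getElem?.1 hup
    exact mem_reachAvoiding_of_suffix h1 h2 h4 hk fun l w _ hw => hp w (List.mem_of_getElem? hw)
  · refine ⟨u :: p, ⟨List.nodup_cons.2 ⟨hup, h1⟩, ?_, ⟨u, rfl, rfl⟩, ?_⟩, ?_⟩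
    · refine h2.cons fun w hw => ?_
      rw [ha] at hw
      obtain rfl := Option.some.inj hw
      exact h
    · obtain ⟨b, hb, hb'⟩ := h4
      refine ⟨b, hb, ?_⟩
      rw [List.getLast?_cons, hb']
      rfl
    · intro w hw
      rcases List.mem_cons.1 hw with rfl | hw
      · exact hu
      · exact hp w hw

/-- A vertex on both a path into `D` and a path out of `D` belongs to a disconnecting set `D`, if
these paths contain no elements of `D` but the last one and the first one, respectively. -/
theorem IsDisconnecting.mem_of_mem_of_mem (hdis : IsDisconnecting E A B D) {p q : List V}
    (hp : p.Nodup) (hpc : p.IsChain E) (hpA : ∃ a ∈ A, p.head? = some a)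
    (hpD : ∀ v ∈ p, v ∈ D → p.getLast? = some v)
    (hq : q.Nodup) (hqc : q.IsChain E) (hqB : ∃ b ∈ B, q.getLast? = some b)
    (hqD : ∀ v ∈ q, v ∈ D → q.head? = some v)
    {v : V} (hvp : v ∈ p) (hvq : v ∈ q) : v ∈ D := by
  by_contra hvD
  obtain ⟨k, hk⟩ := List.mem_iff_getElem?.1 hvp
  obtain ⟨l, hl⟩ := List.mem_iff_getElem?.1 hvq
  have hv : v ∈ reachAvoiding E B D := by
    refine mem_reachAvoiding_of_suffix hq hqc hqB hl fun m u hm hu huD => hvD ?_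
    have h1 := hqD u (List.mem_of_getElem? hu) huD
    rw [List.head?_eq_getElem?] at h1
    have h2 := index_unique hq hu h1
    obtain rfl : m = l := by omega
    rw [hu] at hl
    exact Option.some.inj hl ▸ huD
  have hstart : ∀ (m : ℕ) (u : V), p[m]? = some u → u ∈ reachAvoiding E B D → ∃ a ∈ A,
      a ∈ reachAvoiding E B D := by
    intro m
    induction m with
    | zero =>
      intro u hu hur
      obtain ⟨a, ha, ha'⟩ := hpA
      rw [List.head?_eq_getElem?, hu] at ha'
      exact ⟨u, Option.some.inj ha' ▸ ha, hur⟩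
    | succ m ih =>
      intro u hu hur
      obtain ⟨h1, -⟩ := List.getElem?_eq_some_iff.1 hu
      have h2 : p[m]? = some p[m] := List.getElem?_eq_getElem (by omega)
      have h3 : Consecutive p p[m] u := ⟨m, h2, hu⟩
      refine ih _ h2 (mem_reachAvoiding_of_rel (h3.rel hpc) (fun hD => ?_) hur)
      exact h3.getLast?_ne hp (hpD _ h3.left_mem hD)
  obtain ⟨a, ha, ha'⟩ := hstart k v hk hv
  exact hdis.notMem_reachAvoiding ha ha'

/-- Pigeonhole: the chosen vertices are distinct by disjointness, so they exhaust `S`, and a further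
vertex of `S` on one path would be the chosen vertex of another. Applied to end points, it shows
that a maximal family meets `D` only at its ends. -/
theorem exists_eq_of_disjoint_of_card_le {k : ℕ} {p : Fin k → List V}
    (hdisj : ∀ s t, s ≠ t → List.Disjoint (p s) (p t)) {S : Finset V} (hS : S.card ≤ k)
    (f : Fin k → V) (hf : ∀ s, f s ∈ S) (hfp : ∀ s, f s ∈ p s) :
    (∀ v ∈ S, ∃ s, f s = v) ∧ (∀ s, ∀ v ∈ p s, v ∈ S → f s = v) ∧ S.card = k := by
  classical
  have hinj : Function.Injective f := by
    intro s t hst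
    by_contra hne
    exact hdisj s t hne (hfp s) (hst ▸ hfp t)
  have himg : Finset.univ.image f = S := by
    refine Finset.eq_of_subset_of_card_le ?_ ?_
    · intro v hv
      obtain ⟨s, -, rfl⟩ := Finset.mem_image.1 hv
      exact hf s
    · rw [Finset.card_image_of_injective _ hinj]
      simpa using hS
  have h1 : ∀ v ∈ S, ∃ s, f s = v := by
    intro v hv
    rw [← himg] at hv
    simpa using hv
  refine ⟨h1, fun s v hv hvS => ?_, ?_⟩
  · obtain ⟨t, rfl⟩ := h1 v hvS
    by_cases hst : s = t
    · rw [hst]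
    · exact (hdisj s t hst hv (hfp t)).elim
  · rw [← himg, Finset.card_image_of_injective _ hinj]
    simp

theorem hasDisjointPaths_maxDisjointPaths [Fintype V] (E : V → V → Prop) (A B : Set V) :
    HasDisjointPaths E A B (maxDisjointPaths E A B) :=
  Nat.sSup_mem (s := {k | HasDisjointPaths E A B k})
    ⟨0, fun s => s.elim0, fun s => s.elim0, fun s => s.elim0⟩ (hasDisjointPaths_bddAbove E A B)

end Linking

/-- Concatenating vertex disjoint paths at a disconnecting set: a linking of external signals to
`C̄`, encoded by the map that sends an internal signal to its predecessor on a path of the linking,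
or to itself if there is none. -/
theorem exists_linking {α β : Type*} [Fintype α] [Fintype β] {E : α ⊕ β → α ⊕ β → Prop}
    (hE : ∀ u x, ¬ E u (Sum.inr x)) {j : α} {xj : β} (hxj : E (Sum.inr xj) (Sum.inl j))
    {Xbar : Set β} (hxjX : xj ∉ Xbar) {Cbar : Set α} {D : Finset (α ⊕ β)}
    (hD : IsDisconnecting E (Sum.inr '' Xbar) (Sum.inl '' Cbar) D)
    (h₁ : maxDisjointPaths E ({Sum.inl j} ∪ (D : Set (α ⊕ β))) (Sum.inl '' Cbar) = D.card + 1)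
    (h₂ : maxDisjointPaths E (Sum.inr '' Xbar) (D : Set (α ⊕ β)) = D.card) :
    ∃ (X' : Finset β) (c : α → α ⊕ β), ↑X' ⊆ Xbar ∧ X'.card = D.card ∧ Function.Injective c ∧
      (∀ a, c a = Sum.inl a ∨ E (c a) (Sum.inl a)) ∧
      (∀ w ∉ Cbar, Sum.inl w ∈ Set.range c) ∧
      (∀ x ∈ insert xj (X' : Set β), Sum.inr x ∈ Set.range c) := by
  classical
  obtain ⟨q, hq, hqd⟩ := h₁ ▸ hasDisjointPaths_maxDisjointPaths E
    ({Sum.inl j} ∪ (D : Set (α ⊕ β))) (Sum.inl '' Cbar)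
  obtain ⟨p, hp, hpd⟩ := h₂ ▸ hasDisjointPaths_maxDisjointPaths E
    (Sum.inr '' Xbar) (D : Set (α ⊕ β))
  choose pn pc ph pl using hp
  choose qn qc qh ql using hq
  choose px hpx phx using ph
  choose pe hpe ple using pl
  choose qs hqs qhs using qh
  choose x hx hxp using hpx
  -- the paths `p` meet `D` in their last vertices, and the paths `q` in their first ones
  obtain ⟨pD, pD', -⟩ := exists_eq_of_disjoint_of_card_le hpd le_rfl pe hpe
    fun s => List.mem_of_mem_getLast? (ple s)
  obtain ⟨qD, qD', qcard⟩ := exists_eq_of_disjoint_of_card_le hqd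
    (S := insert (Sum.inl j) D) (Finset.card_insert_le _ _) qs
    (fun s => by simpa [Finset.mem_insert] using hqs s) fun s => List.mem_of_mem_head? (qhs s)
  have hjD : Sum.inl j ∉ D := by
    intro h
    rw [Finset.insert_eq_of_mem h] at qcard
    omega
  have pD'' : ∀ s, ∀ v ∈ p s, v ∈ (D : Set (α ⊕ β)) → (p s).getLast? = some v :=
    fun s v hv hvD => pD' s v hv hvD ▸ ple s
  have qD'' : ∀ s, ∀ v ∈ q s, v = Sum.inl j ∨ v ∈ (D : Set (α ⊕ β)) → (q s).head? = some v :=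
    fun s v hv hvD => qD' s v hv (by simpa using hvD) ▸ qhs s
  -- A common vertex outside `D` would give a route from `X̄` to `C̄` that avoids `D`, since the
  -- `p`-paths touch `D` only at their ends and the `q`-paths only at their beginnings.
  have hcross : ∀ s t v, v ∈ p s → v ∈ q t → v ∈ D := fun s t v hvp hvq =>
    hD.mem_of_mem_of_mem (pn s) (pc s) ⟨_, ⟨_, hx s, rfl⟩, hxp s ▸ phx s⟩ (pD'' s) (qn t) (qc t)
      (ql t) (fun v hv hvD => qD'' t v hv (Or.inr hvD)) hvp hvq
  have hjp : ∀ s, Sum.inl j ∉ p s := by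
    intro s hs
    obtain ⟨t, ht⟩ := qD (Sum.inl j) (Finset.mem_insert_self _ _)
    exact hjD (hcross s t _ hs (ht ▸ List.mem_of_mem_head? (qhs t)))
  have hext : ∀ (l : List (α ⊕ β)), l.IsChain E → ∀ y, Sum.inr y ∈ l →
      l.head? = some (Sum.inr y) := by
    intro l hl y hy
    rcases head?_or_consecutive hy with h | ⟨u, hu⟩
    · exact h
    · exact (hE _ _ (hu.rel hl)).elim
  have hxjp : ∀ s, Sum.inr xj ∉ p s := by
    intro s hs
    have := hext _ (pc s) _ hs
    rw [phx s, ← hxp s] at this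
    exact hxjX (Sum.inr.inj (Option.some.inj this) ▸ hx s)
  have hxjq : ∀ t, Sum.inr xj ∉ q t := by
    intro t ht
    have := hext _ (qc t) _ ht
    rw [qhs t] at this
    have h2 := hqs t
    rw [Option.some.inj this] at h2
    have h3 : Sum.inr xj ∈ D := by simpa using h2
    obtain ⟨s, hs⟩ := pD _ h3
    exact hxjp s (hs ▸ List.mem_of_mem_getLast? (ple s))
  -- The successor relation of the concatenated paths, with the path that starts at `w_j` lengthened
  -- backwards by the edge from `x_j`. It is a partial injection: the two families share only
  -- vertices of `D`, which come last on a `p`-path and first on a `q`-path.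
  let next : α ⊕ β → α ⊕ β → Prop := fun u v =>
    (∃ s, Consecutive (p s) u v) ∨ (∃ t, Consecutive (q t) u v) ∨
      (u = Sum.inr xj ∧ v = Sum.inl j)
  have same_p : ∀ s s' v, v ∈ p s → v ∈ p s' → s = s' := fun s s' v h h' => by
    by_contra hne; exact hpd s s' hne h h'
  have same_q : ∀ s s' v, v ∈ q s → v ∈ q s' → s = s' := fun s s' v h h' => by
    by_contra hne; exact hqd s s' hne h h'
  have next_rel : ∀ u v, next u v → E u v := by
    rintro u v (⟨s, h⟩ | ⟨t, h⟩ | ⟨rfl, rfl⟩)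
    · exact h.rel (pc s)
    · exact h.rel (qc t)
    · exact hxj
  have next_right : ∀ u v v', next u v → next u v' → v = v' := by
    have aux : ∀ s t u v v', Consecutive (p s) u v → Consecutive (q t) u v' → False := by
      intro s t u v v' h h'
      exact h.getLast?_ne (pn s) (pD'' s u h.left_mem (hcross s t u h.left_mem h'.left_mem))
    rintro u v v' (⟨s, h⟩ | ⟨t, h⟩ | ⟨rfl, rfl⟩) (⟨s', h'⟩ | ⟨t', h'⟩ | ⟨h', h''⟩)
    · obtain rfl := same_p s s' u h.left_mem h'.left_mem
      exact h.right_unique (pn s) h'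
    · exact (aux _ _ _ _ _ h h').elim
    · exact (hxjp s (h' ▸ h.left_mem)).elim
    · exact (aux _ _ _ _ _ h' h).elim
    · obtain rfl := same_q t t' u h.left_mem h'.left_mem
      exact h.right_unique (qn t) h'
    · exact (hxjq t (h' ▸ h.left_mem)).elim
    · exact (hxjp _ h'.left_mem).elim
    · exact (hxjq _ h'.left_mem).elim
    · exact h''.symm
  have next_left : ∀ u u' v, next u v → next u' v → u = u' := by
    have aux : ∀ s t u u' v, Consecutive (p s) u v → Consecutive (q t) u' v → False := by
      intro s t u u' v h h'
      exact h'.head?_ne (qn t)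
        (qD'' t v h'.right_mem (Or.inr (hcross s t v h.right_mem h'.right_mem)))
    have auxq : ∀ t u, ¬ Consecutive (q t) u (Sum.inl j) := fun t u h =>
      h.head?_ne (qn t) (qD'' t _ h.right_mem (Or.inl rfl))
    rintro u u' v (⟨s, h⟩ | ⟨t, h⟩ | ⟨rfl, rfl⟩) (⟨s', h'⟩ | ⟨t', h'⟩ | ⟨h', h''⟩)
    · obtain rfl := same_p s s' v h.right_mem h'.right_mem
      exact h.left_unique (pn s) h'
    · exact (aux _ _ _ _ _ h h').elim
    · exact (hjp s (h'' ▸ h.right_mem)).elim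
    · exact (aux _ _ _ _ _ h' h).elim
    · obtain rfl := same_q t t' v h.right_mem h'.right_mem
      exact h.left_unique (qn t) h'
    · exact (auxq t u (h'' ▸ h)).elim
    · exact (hjp _ h'.right_mem).elim
    · exact (auxq _ _ h').elim
    · exact h'.symm
  have next_into : ∀ w v, next (Sum.inl w) v → ∃ u, next u (Sum.inl w) := by
    have auxp : ∀ s w, Sum.inl w ∈ p s → ∃ u, next u (Sum.inl w) := by
      intro s w hw
      rcases head?_or_consecutive hw with h' | ⟨u, hu⟩
      · rw [phx s, ← hxp s] at h'
        exact (Sum.inr_ne_inl (Option.some.inj h')).elim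
      · exact ⟨u, Or.inl ⟨s, hu⟩⟩
    rintro w v (⟨s, h⟩ | ⟨t, h⟩ | ⟨h, -⟩)
    · exact auxp s w h.left_mem
    · rcases head?_or_consecutive h.left_mem with h' | ⟨u, hu⟩
      · rw [qhs t] at h'
        have h2 := hqs t
        rw [Option.some.inj h'] at h2
        rcases h2 with h2 | h2
        · exact ⟨Sum.inr xj, Or.inr (Or.inr ⟨rfl, h2⟩)⟩
        · obtain ⟨s, hs⟩ := pD _ h2
          exact auxp s w (hs ▸ List.mem_of_mem_getLast? (ple s))
      · exact ⟨u, Or.inr (Or.inl ⟨t, hu⟩)⟩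
    · exact (Sum.inl_ne_inr h).elim
  have next_outq : ∀ t v, v ∈ q t → v ∈ Sum.inl '' Cbar ∨ ∃ u, next v u := by
    intro t v hv
    rcases getLast?_or_consecutive hv with h | ⟨u, hu⟩
    · obtain ⟨b, hb, hb'⟩ := ql t
      rw [h] at hb'
      exact Or.inl (Option.some.inj hb' ▸ hb)
    · exact Or.inr ⟨u, Or.inr (Or.inl ⟨t, hu⟩)⟩
  have next_outp : ∀ s v, v ∈ p s → v ∈ Sum.inl '' Cbar ∨ ∃ u, next v u := by
    intro s v hv
    rcases getLast?_or_consecutive hv with h | ⟨u, hu⟩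
    · rw [ple s] at h
      obtain ⟨t, ht⟩ := qD v (Finset.mem_insert_of_mem (Option.some.inj h ▸ hpe s))
      exact next_outq t v (ht ▸ List.mem_of_mem_head? (qhs t))
    · exact Or.inr ⟨u, Or.inl ⟨s, hu⟩⟩
  -- A concatenated path can stop only in `C̄`. A signal outside `C̄` that has a predecessor thus
  -- also has a successor, and so is itself a value of the predecessor map.
  have next_out : ∀ u v, next u v → v ∈ Sum.inl '' Cbar ∨ ∃ u, next v u := by
    rintro u v (⟨s, h⟩ | ⟨t, h⟩ | ⟨-, rfl⟩)
    · exact next_outp s v h.right_mem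
    · exact next_outq t v h.right_mem
    · obtain ⟨t, ht⟩ := qD (Sum.inl j) (Finset.mem_insert_self _ _)
      exact next_outq t _ (ht ▸ List.mem_of_mem_head? (qhs t))
  -- The default value `Sum.inl a` selects the column of `G - I` that has `-1` in row `a`. It never
  -- collides with a predecessor: by `next_into`, an internal signal with a successor has a
  -- predecessor as well.
  let c : α → α ⊕ β := fun a =>
    if h : ∃ u, next u (Sum.inl a) then h.choose else Sum.inl a
  have hc_pos : ∀ a u, next u (Sum.inl a) → c a = u := by
    intro a u hu
    have h : ∃ u, next u (Sum.inl a) := ⟨u, hu⟩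
    simp only [c, dif_pos h]
    exact next_left _ _ _ h.choose_spec hu
  have hc_neg : ∀ a, (¬ ∃ u, next u (Sum.inl a)) → c a = Sum.inl a := by
    intro a h
    simp only [c, dif_neg h]
  have hc_range : ∀ u v, next u v → u ∈ Set.range c := by
    intro u v huv
    cases v with
    | inl a => exact ⟨a, hc_pos a u huv⟩
    | inr y => exact (hE _ _ (next_rel _ _ huv)).elim
  have hxinj : Function.Injective x := by
    intro s t hst
    refine same_p s t (px s) (List.mem_of_mem_head? (phx s)) ?_
    rw [← hxp s, hst, hxp t]
    exact List.mem_of_mem_head? (phx t)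
  refine ⟨Finset.univ.image x, c, ?_, ?_, ?_, ?_, ?_, ?_⟩
  · intro y hy
    obtain ⟨s, -, rfl⟩ := Finset.mem_image.1 (Finset.mem_coe.1 hy)
    exact hx s
  · rw [Finset.card_image_of_injective _ hxinj]
    simp
  · intro a b hab
    by_cases ha : ∃ u, next u (Sum.inl a) <;> by_cases hb : ∃ u, next u (Sum.inl b)
    · obtain ⟨u, hu⟩ := ha
      obtain ⟨v, hv⟩ := hb
      rw [hc_pos a u hu, hc_pos b v hv] at hab
      subst hab
      exact Sum.inl.inj (next_right _ _ _ hu hv)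
    · obtain ⟨u, hu⟩ := ha
      rw [hc_pos a u hu, hc_neg b hb] at hab
      subst hab
      exact (hb (next_into _ _ hu)).elim
    · obtain ⟨v, hv⟩ := hb
      rw [hc_pos b v hv, hc_neg a ha] at hab
      subst hab
      exact (ha (next_into _ _ hv)).elim
    · rw [hc_neg a ha, hc_neg b hb] at hab
      exact Sum.inl.inj hab
  · intro a
    by_cases ha : ∃ u, next u (Sum.inl a)
    · obtain ⟨u, hu⟩ := ha
      rw [hc_pos a u hu]
      exact Or.inr (next_rel _ _ hu)
    · exact Or.inl (hc_neg a ha)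
  · intro w hw
    by_cases ha : ∃ u, next u (Sum.inl w)
    · obtain ⟨u, hu⟩ := ha
      rcases next_out _ _ hu with h | ⟨v, hv⟩
      · obtain ⟨w', hw', h⟩ := h
        exact (hw (Sum.inl.inj h ▸ hw')).elim
      · exact hc_range _ _ hv
    · exact ⟨w, hc_neg w ha⟩
  · intro y hy
    rcases hy with rfl | hy
    · exact hc_range (Sum.inr y) (Sum.inl j) (Or.inr (Or.inr ⟨rfl, rfl⟩))
    · obtain ⟨s, -, rfl⟩ := Finset.mem_image.1 (Finset.mem_coe.1 hy)
      rcases next_outp s (px s) (List.mem_of_mem_head? (phx s)) with h | ⟨v, hv⟩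
      · obtain ⟨w, -, h⟩ := h
        rw [← hxp s] at h
        exact (Sum.inl_ne_inr h).elim
      · exact hxp s ▸ hc_range _ _ hv

/-! ### Generic nonsingularity -/

/-- Induction with Fubini: the leading coefficient in the first variable is nonzero for almost all
values of the others, and then only finitely many values of the first variable are roots. -/
theorem ae_eval_ne_zero {n : ℕ} {p : MvPolynomial (Fin n) ℝ} (hp : p ≠ 0) :
    ∀ᵐ x : Fin n → ℝ, MvPolynomial.eval x p ≠ 0 := by
  induction n with
  | zero =>
    refine Filter.Eventually.of_forall fun x h => hp ?_
    rw [MvPolynomial.eq_C_of_isEmpty p] at h ⊢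
    simpa using h
  | succ n ih =>
    have hP : MvPolynomial.finSuccEquiv ℝ n p ≠ 0 := by simpa using hp
    have hc := Polynomial.leadingCoeff_ne_zero.2 hP
    have hmeas : MeasurableSet {z : ℝ × (Fin n → ℝ) |
        MvPolynomial.eval (Fin.cons z.1 z.2 : Fin (n + 1) → ℝ) p ≠ 0} := by
      have : Continuous fun z : ℝ × (Fin n → ℝ) =>
          MvPolynomial.eval (Fin.cons z.1 z.2 : Fin (n + 1) → ℝ) p := by
        refine (MvPolynomial.continuous_eval p).comp (continuous_pi fun i => ?_)
        refine Fin.cases ?_ (fun i => ?_) i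
        · simpa using continuous_fst
        · simp only [Fin.cons_succ]
          fun_prop
      exact (isOpen_ne_fun this continuous_const).measurableSet
    have hae : ∀ᵐ y : ℝ, ∀ᵐ s : Fin n → ℝ,
        MvPolynomial.eval (Fin.cons y s : Fin (n + 1) → ℝ) p ≠ 0 := by
      rw [Measure.ae_ae_comm hmeas]
      filter_upwards [ih hc] with s hs
      have hne : (MvPolynomial.finSuccEquiv ℝ n p).map (MvPolynomial.eval s) ≠ 0 := by
        intro h0
        apply hs
        rw [Polynomial.leadingCoeff, ← Polynomial.coeff_map, h0, Polynomial.coeff_zero]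
      have hfin : {y : ℝ | ((MvPolynomial.finSuccEquiv ℝ n p).map
          (MvPolynomial.eval s)).IsRoot y}.Finite :=
        Polynomial.finite_setOfPred_isRoot hne
      filter_upwards [hfin.countable.ae_notMem volume] with y hy h0
      apply hy
      rw [MvPolynomial.eval_eq_eval_mv_eval'] at h0
      exact h0
    have hae := (Measure.ae_prod_mem_iff_ae_ae_mem hmeas).2 hae
    have := (volume_preserving_piFinSuccAbove (fun _ : Fin (n + 1) => ℝ)
      0).quasiMeasurePreserving.ae hae
    filter_upwards [this] with x hx
    have hcons : x = Fin.cons (MeasurableEquiv.piFinSuccAbove (fun _ => ℝ) 0 x).1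
        (MeasurableEquiv.piFinSuccAbove (fun _ => ℝ) 0 x).2 := (Fin.cons_self_tail x).symm
    rw [hcons]
    exact hx

namespace NetworkModelSet

theorem specialize_congr {n : ℕ} {S : Set (Fin n)} {θ θ' : Fin n → ℝ}
    {p : Polynomial (MvPolynomial (Fin n) ℝ)}
    (hp : ∀ k, p.coeff k ∈ MvPolynomial.supported ℝ S) (h : ∀ k ∈ S, θ k = θ' k) :
    specialize θ p = specialize θ' p := by
  ext k
  simp only [specialize, Polynomial.coeff_map]
  refine MvPolynomial.eval₂Hom_congr' rfl ?_ rfl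
  intro i hi _
  exact h i (MvPolynomial.mem_supported.1 (hp k) hi)

theorem IsRationalIn.mono {n : ℕ} {Θ : Set (Fin n → ℝ)} {S S' : Set (Fin n)}
    {f : (Fin n → ℝ) → RatFunc ℝ} (h : IsRationalIn Θ S f) (hS : S ⊆ S') :
    IsRationalIn Θ S' f := by
  obtain ⟨p, q, hp, hq, hf⟩ := h
  exact ⟨p, q, fun k => MvPolynomial.supported_mono hS (hp k),
    fun k => MvPolynomial.supported_mono hS (hq k), hf⟩

theorem isRationalIn_const {n : ℕ} {Θ : Set (Fin n → ℝ)} {S : Set (Fin n)} (r : ℝ) :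
    IsRationalIn Θ S fun _ => RatFunc.C r := by
  refine ⟨Polynomial.C (MvPolynomial.C r), 1, fun k => ?_, fun k => ?_, fun θ _ => ?_⟩
  · rw [Polynomial.coeff_C]
    split_ifs
    · exact (MvPolynomial.supported ℝ S).algebraMap_mem r
    · exact zero_mem _
  · rw [Polynomial.coeff_one]
    split_ifs
    · exact one_mem _
    · exact zero_mem _
  · simp [specialize, RatFunc.algebraMap_C]

theorem IsRationalIn.sub_const {n : ℕ} {Θ : Set (Fin n → ℝ)} {S : Set (Fin n)}
    {f : (Fin n → ℝ) → RatFunc ℝ} (h : IsRationalIn Θ S f) (r : ℝ) :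
    IsRationalIn Θ S fun θ => f θ - RatFunc.C r := by
  obtain ⟨p, q, hp, hq, hf⟩ := h
  refine ⟨p - Polynomial.C (MvPolynomial.C r) * q, q, fun k => ?_, hq, fun θ hθ => ?_⟩
  · rw [Polynomial.coeff_sub, Polynomial.coeff_C_mul]
    exact sub_mem (hp k) (mul_mem ((MvPolynomial.supported ℝ S).algebraMap_mem r) (hq k))
  · obtain ⟨h1, h2⟩ := hf θ hθ
    refine ⟨h1, ?_⟩
    beta_reduce
    have h3 : algebraMap (Polynomial ℝ) (RatFunc ℝ) (specialize θ q) ≠ 0 := by simpa using h1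
    rw [h2]
    field_simp
    simp [specialize, RatFunc.algebraMap_C, mul_comm]

/-- A square matrix with independent rational entries is generically nonsingular, if all its
parameter independent blocks have rank at least `|I| + |J| - n`. -/
theorem ae_det_ne_zero {n : ℕ} {ι : Type*} [Fintype ι] [DecidableEq ι] {Θ : Set (Fin n → ℝ)}
    {A : (Fin n → ℝ) → Matrix ι ι (RatFunc ℝ)} {S : ι → ι → Set (Fin n)}
    (hS : ∀ k a b a' b', k ∈ S a b → k ∈ S a' b' → a = a' ∧ b = b')
    (hA : ∀ a b, IsRationalIn Θ (S a b) fun θ => A θ a b)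
    (hblock : ∀ I J : Finset ι,
      (∀ a ∈ I, ∀ b ∈ J, ∀ θ ∈ Θ, ∀ θ' ∈ Θ, A θ a b = A θ' a b) → ∀ θ ∈ Θ,
        Module.finrank (RatFunc ℝ) (blockKernel (A θ) I J) + I.card ≤ Fintype.card ι) :
    ∀ᵐ θ : Fin n → ℝ, θ ∈ Θ → (A θ).det ≠ 0 := by
  classical
  rcases Θ.eq_empty_or_nonempty with rfl | ⟨θ₀, hθ₀⟩
  · exact Filter.Eventually.of_forall fun θ h => h.elim
  -- two values for every entry, different if possible
  have hval : ∀ a b, ∃ t₁ ∈ Θ, ∃ t₂ ∈ Θ, A t₁ a b = A t₂ a b →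
      ∀ θ ∈ Θ, ∀ θ' ∈ Θ, A θ a b = A θ' a b := by
    intro a b
    by_cases h : ∀ θ ∈ Θ, ∀ θ' ∈ Θ, A θ a b = A θ' a b
    · exact ⟨θ₀, hθ₀, θ₀, hθ₀, fun _ => h⟩
    · push Not at h
      obtain ⟨t₁, h₁, t₂, h₂, hne⟩ := h
      exact ⟨t₁, h₁, t₂, h₂, fun h => (hne h).elim⟩
  choose t₁ ht₁ t₂ ht₂ ht using hval
  obtain ⟨M, hM, hdet⟩ := exists_det_ne_zero_of_blockKernel
    (Matrix.of fun a b => A (t₁ a b) a b) (Matrix.of fun a b => A (t₂ a b) a b) (by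
      intro I J hIJ
      have hk : ∀ a ∈ I, ∀ b ∈ J, ∀ θ ∈ Θ, ∀ θ' ∈ Θ, A θ a b = A θ' a b :=
        fun a ha b hb => ht a b (hIJ a ha b hb)
      rw [blockKernel_congr (A := Matrix.of fun a b => A (t₁ a b) a b) (B := A θ₀)
        fun a ha b hb => hk a ha b hb _ (ht₁ a b) _ hθ₀]
      exact hblock I J hk θ₀ hθ₀)
  have hM' : ∀ a b, ∃ t ∈ Θ, M a b = A t a b := by
    intro a b
    rcases hM a b with h | h
    · exact ⟨_, ht₁ a b, h⟩
    · exact ⟨_, ht₂ a b, h⟩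
  choose t htΘ htM using hM'
  choose p q hp hq hpq using hA
  -- one parameter vector that realizes all these values
  let θs : Fin n → ℝ := fun k => if h : ∃ ab : ι × ι, k ∈ S ab.1 ab.2 then
    t h.choose.1 h.choose.2 k else 0
  have hθs : ∀ a b, ∀ k ∈ S a b, θs k = t a b k := by
    intro a b k hk
    have h : ∃ ab : ι × ι, k ∈ S ab.1 ab.2 := ⟨(a, b), hk⟩
    simp only [θs, dif_pos h]
    obtain ⟨h1, h2⟩ := hS k _ _ _ _ h.choose_spec hk
    rw [h1, h2]
  let ψ : (Fin n → ℝ) → Polynomial (MvPolynomial (Fin n) ℝ) →+* RatFunc ℝ := fun θ =>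
    (algebraMap (Polynomial ℝ) (RatFunc ℝ)).comp (Polynomial.mapRingHom (MvPolynomial.eval θ))
  have hψ : ∀ θ r, ψ θ r = algebraMap (Polynomial ℝ) (RatFunc ℝ) (specialize θ r) :=
    fun θ r => rfl
  -- Clearing all denominators gives a matrix over the ring of polynomials in `z` and the
  -- parameters, whose specialized determinant is the original one up to a nonzero factor. One
  -- polynomial then governs all `θ`.
  let Q : Polynomial (MvPolynomial (Fin n) ℝ) := ∏ ab : ι × ι, q ab.1 ab.2
  let B : Matrix ι ι (Polynomial (MvPolynomial (Fin n) ℝ)) := Matrix.of fun a b =>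
    p a b * ∏ ab ∈ Finset.univ.erase (a, b), q ab.1 ab.2
  have hdetB : ∀ θ (N : Matrix ι ι (RatFunc ℝ)), (∀ a b, ψ θ (q a b) ≠ 0) →
      (∀ a b, N a b = ψ θ (p a b) / ψ θ (q a b)) →
      ψ θ B.det = ψ θ Q ^ Fintype.card ι * N.det := by
    intro θ N h1 h2
    rw [RingHom.map_det, ← Matrix.det_smul]
    congr 1
    ext a b
    have h3 : Q = q a b * ∏ ab ∈ Finset.univ.erase (a, b), q ab.1 ab.2 :=
      (Finset.mul_prod_erase Finset.univ (fun ab : ι × ι => q ab.1 ab.2)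
        (Finset.mem_univ (a, b))).symm
    have h4 := h1 a b
    simp only [RingHom.mapMatrix_apply, Matrix.map_apply, Matrix.smul_apply, smul_eq_mul, B,
      Matrix.of_apply, h2, h3, map_mul]
    field_simp
  -- `θs` need not belong to `Θ`. The polynomials `p a b` and `q a b` involve only parameters of
  -- their own entry, on which `θs` agrees with `t a b ∈ Θ`, so nonvanishing denominators and entry
  -- values carry over.
  have hBne : B.det ≠ 0 := by
    intro h0
    have := hdetB θs M (fun a b => ?_) (fun a b => ?_)
    · rw [h0, map_zero] at this
      refine mul_ne_zero (pow_ne_zero _ ?_) hdet this.symm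
      rw [map_prod]
      refine Finset.prod_ne_zero_iff.2 fun ab _ => ?_
      rw [hψ, specialize_congr (hq ab.1 ab.2) (hθs ab.1 ab.2)]
      simpa using (hpq ab.1 ab.2 _ (htΘ _ _)).1
    · rw [hψ, specialize_congr (hq a b) (hθs a b)]
      simpa using (hpq a b _ (htΘ _ _)).1
    · rw [hψ, hψ, specialize_congr (hq a b) (hθs a b), specialize_congr (hp a b) (hθs a b),
        htM a b]
      exact (hpq a b _ (htΘ _ _)).2
  -- The leading coefficient in `z` is a nonzero polynomial in the parameters. Where it does not
  -- vanish, the specialized determinant is a nonzero polynomial in `z`.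
  filter_upwards [ae_eval_ne_zero (Polynomial.leadingCoeff_ne_zero.2 hBne)] with θ hθ hθΘ h0
  have h1 := hdetB θ (A θ) (fun a b => by simpa [hψ] using (hpq a b θ hθΘ).1)
    (fun a b => (hpq a b θ hθΘ).2)
  rw [h0, mul_zero, hψ, map_eq_zero_iff _ (RatFunc.algebraMap_injective ℝ)] at h1
  apply hθ
  rw [Polynomial.leadingCoeff, ← Polynomial.coeff_map]
  exact (congrArg (fun r : Polynomial ℝ => r.coeff B.det.natDegree) h1).trans
    (Polynomial.coeff_zero _)

variable {L K n : ℕ} (M : NetworkModelSet L K n)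

/-- Columns of `[G - I  X]` that are matched to the rows by edges are generically linearly
independent. -/
theorem ae_det_systemMatrix_ne_zero (hreg : ∀ θ ∈ M.Θ, M.IsRegularAt θ)
    (hindep : M.IsIndependentlyParameterized) (hfixed : M.HasRegularFixedEntries)
    {c : Fin L → M.Vert} (hc : Function.Injective c)
    (hcE : ∀ a, c a = Sum.inl a ∨ M.Edge (c a) (Sum.inl a)) :
    ∀ᵐ θ : Fin n → ℝ, θ ∈ M.Θ → ((M.systemMatrix θ).submatrix id c).det ≠ 0 := by
  classical
  rcases M.Θ.eq_empty_or_nonempty with hΘ | ⟨θ₀, hθ₀⟩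
  · exact Filter.Eventually.of_forall fun θ h => by simp [hΘ] at h
  obtain ⟨owner, hG, hH⟩ := hindep
  let own : Fin n → Fin L × M.Vert := fun k =>
    Sum.elim (fun ab => (ab.1, Sum.inl ab.2)) (fun ab => (ab.1.1, Sum.inr (Sum.inr ab.2)))
      (owner k)
  refine ae_det_ne_zero (S := fun a b => {k | own k = (a, c b)}) ?_ ?_ ?_
  · intro k a b a' b' h h'
    have := h.symm.trans h'
    simp only [Prod.mk.injEq] at this
    exact ⟨this.1, hc this.2⟩
  · intro a b
    simp only [Matrix.submatrix_apply, id]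
    generalize c b = v
    rcases v with v | v | v
    · have := ((hG a v).mono (S' := {k | own k = (a, Sum.inl v)}) (by
        intro k hk
        simp only [Set.mem_ofPred_eq] at hk
        simp [own, hk])).sub_const (if a = v then 1 else 0)
      convert this using 2 with θ
      by_cases h : a = v <;> simp [systemMatrix, h]
    · have : IsRationalIn M.Θ {k | own k = (a, Sum.inr (Sum.inl v))} fun _ =>
          RatFunc.C (if a = M.exc v then (1 : ℝ) else 0) := isRationalIn_const _
      convert this using 2 with θ
      by_cases h : a = M.exc v <;> simp [systemMatrix, X, R, h]
    · by_cases ha : a ∈ M.C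
      · have := (hH ⟨a, ha⟩ v).mono (S' := {k | own k = (a, Sum.inr (Sum.inr v))}) (by
          intro k hk
          simp only [Set.mem_ofPred_eq] at hk
          simp [own, hk])
        convert this using 2 with θ
        simp [systemMatrix, X, Hfull, ha]
      · have : IsRationalIn M.Θ {k | own k = (a, Sum.inr (Sum.inr v))} fun _ =>
          RatFunc.C (0 : ℝ) := isRationalIn_const _
        convert this using 2 with θ
        simp [systemMatrix, X, Hfull, ha]
  · intro I J hk θ hθ
    -- a nonsingular matrix with the zero pattern of the whole matrix
    have hdiag : ∀ a, ∃ θ ∈ M.Θ, M.systemMatrix θ a (c a) ≠ 0 := by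
      intro a
      have h0 : ∀ θ ∈ M.Θ, M.systemMatrix θ a (Sum.inl a) ≠ 0 := by
        intro θ hθ
        simp [systemMatrix, (hreg θ hθ).G_hollow a]
      rcases hcE a with h | ⟨a', h, θ, hθ, hne⟩
      · rw [h]
        exact ⟨θ₀, hθ₀, h0 θ₀ hθ₀⟩
      · obtain rfl := Sum.inl.inj h
        refine ⟨θ, hθ, ?_⟩
        by_cases hca : c a = Sum.inl a
        · rw [hca]; exact h0 θ hθ
        · convert hne using 1
          rcases hv : c a with v | v
          · have : a ≠ v := by rintro rfl; exact hca hv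
            simp [systemMatrix, entry, this]
          · simp [systemMatrix, entry]
    let Z : Fin L → Fin L → Prop := fun a b => ∃ θ ∈ M.Θ, M.systemMatrix θ a (c b) ≠ 0
    -- The values `1` and `2` only have to be distinct and nonzero, so a block without choice is a
    -- zero block. The nonzero diagonal makes its row and column sets disjoint, which already gives
    -- the required bound.
    obtain ⟨N, hN, hNdet⟩ := exists_det_ne_zero_of_blockKernel
      (Matrix.of fun a b => if Z a b then (1 : RatFunc ℝ) else 0)
      (Matrix.of fun a b => if Z a b then (2 : RatFunc ℝ) else 0) (by
        intro I J hIJ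
        have h1 := finrank_blockKernel_add_rank
          (Matrix.of fun a b => if Z a b then (1 : RatFunc ℝ) else 0) I J
        have h2 : Disjoint I J := by
          rw [Finset.disjoint_left]
          intro a ha hb
          have h3 := hIJ a ha a hb
          have h4 : Z a a := hdiag a
          simp [h4] at h3
        have h3 := Finset.card_le_univ (I ∪ J)
        rw [Finset.card_union_of_disjoint h2] at h3
        omega)
    have hNZ : ∀ a b, N a b = 0 ↔ ¬ Z a b := by
      intro a b
      have := hN a b
      by_cases h : Z a b
      · simp only [Matrix.of_apply, h, if_true] at this
        rcases this with h' | h' <;> simp [h', h]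
      · simp only [Matrix.of_apply, h, if_false, or_self] at this
        simp [this, h]
    have h1 := finrank_blockKernel_add_rank ((M.systemMatrix θ).submatrix id c) I J
    have h2 := finrank_blockKernel_add_rank N I J
    -- kernels of blocks of a nonsingular matrix
    have h3 : Module.finrank (RatFunc ℝ) (blockKernel N I J) + I.card ≤ L := by
      have hinj : Function.Injective N.mulVecLin := by
        rw [← LinearMap.ker_eq_bot, LinearMap.ker_eq_bot']
        intro v hv
        by_contra hne
        exact hNdet (Matrix.exists_mulVec_eq_zero_iff.1 ⟨v, hne, by simpa using hv⟩)
      -- `N` maps the block kernel injectively into the vectors that vanish on `I`, a space of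
      -- dimension `L - |I|`.
      have hle : (blockKernel N I J).map N.mulVecLin ≤ blockKernel (1 : Matrix (Fin L) (Fin L)
          (RatFunc ℝ)) ∅ Iᶜ := by
        rintro _ ⟨x, ⟨-, hx⟩, rfl⟩
        refine ⟨fun b hb => ?_, by simp⟩
        simpa using hx b (by simpa using hb)
      have h4 := Submodule.finrank_mono hle
      rw [← (Submodule.equivMapOfInjective _ hinj _).finrank_eq] at h4
      have h5 := finrank_blockKernel_add_rank (1 : Matrix (Fin L) (Fin L) (RatFunc ℝ)) ∅ Iᶜ
      have h6 := Finset.card_add_card_compl I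
      simp only [Fintype.card_fin] at h6
      omega
    -- On a fixed block the pattern at `θ` is the pattern over all of `Θ`. The block of `N` thus
    -- competes in the structural rank, which equals the actual rank by assumption.
    have h4 : (N.submatrix (Subtype.val : I → Fin L) (Subtype.val : J → Fin L)).rank ≤
        (((M.systemMatrix θ).submatrix id c).submatrix (Subtype.val : I → Fin L)
          (Subtype.val : J → Fin L)).rank := by
      let e : (J.map ⟨c, hc⟩ : Finset M.Vert) ≃ J :=
        (Equiv.ofBijective (fun b : J => (⟨c b, Finset.mem_map_of_mem ⟨c, hc⟩ b.2⟩ :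
          (J.map ⟨c, hc⟩ : Finset M.Vert))) ⟨fun b b' h => Subtype.ext (hc (by simpa using h)), by
            rintro ⟨v, hv⟩
            obtain ⟨b, hb, rfl⟩ := Finset.mem_map.1 hv
            exact ⟨⟨b, hb⟩, rfl⟩⟩).symm
      have he : ∀ v, c (e v) = v := fun v => congrArg Subtype.val (e.symm_apply_apply v)
      have hreg' := hfixed I (J.map ⟨c, hc⟩) (by
        intro a ha v hv
        obtain ⟨b, hb, rfl⟩ := Finset.mem_map.1 hv
        exact hk a ha b hb) θ hθ
      have h5 : ((M.systemMatrix θ).submatrix (Subtype.val : I → Fin L)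
          (Subtype.val : (J.map ⟨c, hc⟩ : Finset M.Vert) → M.Vert)) =
          (((M.systemMatrix θ).submatrix id c).submatrix (Subtype.val : I → Fin L)
          (Subtype.val : J → Fin L)).submatrix (Equiv.refl _) e := by
        ext a v
        simp [he]
      have h6 : (((M.systemMatrix θ).submatrix id c).submatrix (Subtype.val : I → Fin L)
          (Subtype.val : J → Fin L)).rank = structuralRank
            ((M.systemMatrix θ).submatrix (Subtype.val : I → Fin L)
          (Subtype.val : (J.map ⟨c, hc⟩ : Finset M.Vert) → M.Vert)) := by
        rw [← hreg', h5, Matrix.rank_submatrix]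
      rw [h6]
      refine le_csSup ⟨Fintype.card (J.map ⟨c, hc⟩ : Finset M.Vert), ?_⟩
        ⟨(N.submatrix (Subtype.val : I → Fin L) (Subtype.val : J → Fin L)).submatrix
          (Equiv.refl _) e, ?_, Matrix.rank_submatrix _ _ _⟩
      · rintro r ⟨N', -, rfl⟩
        exact Matrix.rank_le_card_width N'
      · intro a v
        simp only [Matrix.submatrix_apply, Equiv.refl_apply, hNZ, Z]
        push Not
        constructor
        · intro h
          have := h θ hθ
          rwa [he] at this
        · intro h θ' hθ'
          rw [he]
          have := hk a a.2 (e v) (e v).2 θ' hθ' θ hθ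
          simp only [Matrix.submatrix_apply, id, he] at this
          rw [this, h]
    simp only [Fintype.card_fin]
    omega

end NetworkModelSet

/-! ### The limit of transfer functions at infinity -/

/-- The transfer function `f` is proper with limit `c` at infinity. -/
def HasLimitAtInfinity (f : RatFunc ℝ) (c : ℝ) : Prop :=
  ∃ (p q : Polynomial ℝ) (N : ℕ), p.natDegree ≤ N ∧ q.natDegree ≤ N ∧ q.coeff N ≠ 0 ∧
    f = algebraMap (Polynomial ℝ) (RatFunc ℝ) p / algebraMap (Polynomial ℝ) (RatFunc ℝ) q ∧
    c = p.coeff N / q.coeff N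

theorem HasLimitAtInfinity.const (r : ℝ) : HasLimitAtInfinity (RatFunc.C r) r :=
  ⟨Polynomial.C r, 1, 0, by simp, by simp, by simp, by simp [RatFunc.algebraMap_C], by simp⟩

theorem algebraMap_ne_zero_of_coeff_ne_zero {q : Polynomial ℝ} {N : ℕ} (h : q.coeff N ≠ 0) :
    algebraMap (Polynomial ℝ) (RatFunc ℝ) q ≠ 0 := by
  rw [map_ne_zero_iff _ (RatFunc.algebraMap_injective ℝ)]
  rintro rfl
  simp at h

theorem HasLimitAtInfinity.add {f g : RatFunc ℝ} {c d : ℝ} (hf : HasLimitAtInfinity f c)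
    (hg : HasLimitAtInfinity g d) : HasLimitAtInfinity (f + g) (c + d) := by
  obtain ⟨p, q, N, hp, hq, hq0, rfl, rfl⟩ := hf
  obtain ⟨p', q', N', hp', hq', hq0', rfl, rfl⟩ := hg
  refine ⟨p * q' + q * p', q * q', N + N', ?_, ?_, ?_, ?_, ?_⟩
  · exact Polynomial.natDegree_add_le_of_degree_le (Polynomial.natDegree_mul_le_of_le hp hq')
      (Polynomial.natDegree_mul_le_of_le hq hp')
  · exact Polynomial.natDegree_mul_le_of_le hq hq'
  · rw [Polynomial.coeff_mul_add_eq_of_natDegree_le hq hq']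
    exact mul_ne_zero hq0 hq0'
  · rw [div_add_div _ _ (algebraMap_ne_zero_of_coeff_ne_zero hq0)
      (algebraMap_ne_zero_of_coeff_ne_zero hq0')]
    simp
  · rw [Polynomial.coeff_add, Polynomial.coeff_mul_add_eq_of_natDegree_le hq hq',
      Polynomial.coeff_mul_add_eq_of_natDegree_le hp hq',
      Polynomial.coeff_mul_add_eq_of_natDegree_le hq hp', div_add_div _ _ hq0 hq0']

theorem HasLimitAtInfinity.mul {f g : RatFunc ℝ} {c d : ℝ} (hf : HasLimitAtInfinity f c)
    (hg : HasLimitAtInfinity g d) : HasLimitAtInfinity (f * g) (c * d) := by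
  obtain ⟨p, q, N, hp, hq, hq0, rfl, rfl⟩ := hf
  obtain ⟨p', q', N', hp', hq', hq0', rfl, rfl⟩ := hg
  refine ⟨p * p', q * q', N + N', ?_, ?_, ?_, ?_, ?_⟩
  · exact Polynomial.natDegree_mul_le_of_le hp hp'
  · exact Polynomial.natDegree_mul_le_of_le hq hq'
  · rw [Polynomial.coeff_mul_add_eq_of_natDegree_le hq hq']
    exact mul_ne_zero hq0 hq0'
  · rw [div_mul_div_comm]
    simp
  · rw [Polynomial.coeff_mul_add_eq_of_natDegree_le hq hq',
      Polynomial.coeff_mul_add_eq_of_natDegree_le hp hp', div_mul_div_comm]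

theorem HasLimitAtInfinity.inv {f : RatFunc ℝ} {c : ℝ} (hf : HasLimitAtInfinity f c)
    (hc : c ≠ 0) : HasLimitAtInfinity f⁻¹ c⁻¹ := by
  obtain ⟨p, q, N, hp, hq, hq0, rfl, rfl⟩ := hf
  refine ⟨q, p, N, hq, hp, ?_, by simp, by simp⟩
  intro h
  simp [h] at hc

theorem HasLimitAtInfinity.unique {f : RatFunc ℝ} {c d : ℝ} (hf : HasLimitAtInfinity f c)
    (hg : HasLimitAtInfinity f d) : c = d := by
  obtain ⟨p, q, N, hp, hq, hq0, rfl, rfl⟩ := hf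
  obtain ⟨p', q', N', hp', hq', hq0', h, rfl⟩ := hg
  rw [div_eq_div_iff (algebraMap_ne_zero_of_coeff_ne_zero hq0)
    (algebraMap_ne_zero_of_coeff_ne_zero hq0'), ← map_mul, ← map_mul] at h
  have h' := RatFunc.algebraMap_injective ℝ h
  have h2 := congrArg (fun r => r.coeff (N + N')) h'
  simp only [Polynomial.coeff_mul_add_eq_of_natDegree_le hp hq'] at h2
  rw [add_comm, Polynomial.coeff_mul_add_eq_of_natDegree_le hp' hq] at h2
  rw [div_eq_div_iff hq0 hq0', h2]

theorem IsProper.hasLimitAtInfinity {f : RatFunc ℝ} (hf : IsProper f) :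
    HasLimitAtInfinity f (feedthrough f) :=
  ⟨f.num, f.denom, f.denom.natDegree, Polynomial.natDegree_le_natDegree hf, le_rfl,
    by simp [f.denom_ne_zero], (RatFunc.num_div_denom f).symm, rfl⟩

theorem HasLimitAtInfinity.isProper {f : RatFunc ℝ} {c : ℝ} (hf : HasLimitAtInfinity f c) :
    IsProper f := by
  obtain ⟨p, q, N, hp, hq, hq0, h, -⟩ := hf
  have hqd : q.degree = N := le_antisymm (Polynomial.degree_le_of_natDegree_le hq)
    (Polynomial.le_degree_of_ne_zero hq0)
  have hpd : p.degree ≤ N := Polynomial.degree_le_of_natDegree_le hp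
  have hd : algebraMap (Polynomial ℝ) (RatFunc ℝ) f.denom ≠ 0 := by simp [f.denom_ne_zero]
  have h1 := RatFunc.num_div_denom f
  rw [h, div_eq_div_iff (h ▸ hd) (algebraMap_ne_zero_of_coeff_ne_zero hq0), ← map_mul,
    ← map_mul, ← h] at h1
  have h2 := congrArg Polynomial.degree (RatFunc.algebraMap_injective ℝ h1)
  rw [Polynomial.degree_mul, Polynomial.degree_mul, hqd] at h2
  have h3 : f.num.degree + N ≤ f.denom.degree + N := by
    rw [h2, add_comm f.denom.degree]
    gcongr
  exact (WithBot.add_le_add_iff_right (by simp)).1 h3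

theorem HasLimitAtInfinity.feedthrough_eq {f : RatFunc ℝ} {c : ℝ} (hf : HasLimitAtInfinity f c) :
    feedthrough f = c :=
  hf.isProper.hasLimitAtInfinity.unique hf

theorem hasLimitAtInfinity_zero : HasLimitAtInfinity 0 0 := by
  simpa using HasLimitAtInfinity.const 0

theorem hasLimitAtInfinity_one : HasLimitAtInfinity 1 1 := by
  simpa using HasLimitAtInfinity.const 1

theorem HasLimitAtInfinity.neg {f : RatFunc ℝ} {c : ℝ} (hf : HasLimitAtInfinity f c) :
    HasLimitAtInfinity (-f) (-c) := by
  simpa using (HasLimitAtInfinity.const (-1)).mul hf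

theorem HasLimitAtInfinity.sub {f g : RatFunc ℝ} {c d : ℝ} (hf : HasLimitAtInfinity f c)
    (hg : HasLimitAtInfinity g d) : HasLimitAtInfinity (f - g) (c - d) := by
  simpa [sub_eq_add_neg] using hf.add hg.neg

theorem hasLimitAtInfinity_sum {ι : Type*} (s : Finset ι) {f : ι → RatFunc ℝ} {c : ι → ℝ}
    (h : ∀ i ∈ s, HasLimitAtInfinity (f i) (c i)) :
    HasLimitAtInfinity (∑ i ∈ s, f i) (∑ i ∈ s, c i) := by
  classical
  induction s using Finset.induction_on with
  | empty => simpa using hasLimitAtInfinity_zero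
  | insert i s hi ih =>
    rw [Finset.sum_insert hi, Finset.sum_insert hi]
    exact (h i (Finset.mem_insert_self _ _)).add
      (ih fun k hk => h k (Finset.mem_insert_of_mem hk))

theorem hasLimitAtInfinity_prod {ι : Type*} (s : Finset ι) {f : ι → RatFunc ℝ} {c : ι → ℝ}
    (h : ∀ i ∈ s, HasLimitAtInfinity (f i) (c i)) :
    HasLimitAtInfinity (∏ i ∈ s, f i) (∏ i ∈ s, c i) := by
  classical
  induction s using Finset.induction_on with
  | empty => simpa using hasLimitAtInfinity_one
  | insert i s hi ih =>
    rw [Finset.prod_insert hi, Finset.prod_insert hi]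
    exact (h i (Finset.mem_insert_self _ _)).mul
      (ih fun k hk => h k (Finset.mem_insert_of_mem hk))

section MatrixLimit

variable {ι κ μ : Type*}

/-- Entrywise limits at infinity. -/
def MatrixHasLimitAtInfinity (A : Matrix ι κ (RatFunc ℝ)) (A' : Matrix ι κ ℝ) : Prop :=
  ∀ a b, HasLimitAtInfinity (A a b) (A' a b)

theorem MatrixHasLimitAtInfinity.unique {A : Matrix ι κ (RatFunc ℝ)} {A' A'' : Matrix ι κ ℝ}
    (h : MatrixHasLimitAtInfinity A A') (h' : MatrixHasLimitAtInfinity A A'') : A' = A'' := by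
  ext a b
  exact (h a b).unique (h' a b)

theorem MatrixHasLimitAtInfinity.mul [Fintype κ] {A : Matrix ι κ (RatFunc ℝ)}
    {A' : Matrix ι κ ℝ} {B : Matrix κ μ (RatFunc ℝ)} {B' : Matrix κ μ ℝ}
    (hA : MatrixHasLimitAtInfinity A A') (hB : MatrixHasLimitAtInfinity B B') :
    MatrixHasLimitAtInfinity (A * B) (A' * B') := fun a b =>
  hasLimitAtInfinity_sum _ fun k _ => (hA a k).mul (hB k b)

theorem matrixHasLimitAtInfinity_map_C (A : Matrix ι κ ℝ) :
    MatrixHasLimitAtInfinity (A.map RatFunc.C) A := fun _ _ => HasLimitAtInfinity.const _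

theorem MatrixHasLimitAtInfinity.submatrix {ι' κ' : Type*} {A : Matrix ι κ (RatFunc ℝ)}
    {A' : Matrix ι κ ℝ} (h : MatrixHasLimitAtInfinity A A') (r : ι' → ι) (c : κ' → κ) :
    MatrixHasLimitAtInfinity (A.submatrix r c) (A'.submatrix r c) := fun a b => h (r a) (c b)

variable [Fintype ι] [DecidableEq ι] {A : Matrix ι ι (RatFunc ℝ)} {A' : Matrix ι ι ℝ}

theorem MatrixHasLimitAtInfinity.det (h : MatrixHasLimitAtInfinity A A') :
    HasLimitAtInfinity A.det A'.det := by
  rw [Matrix.det_apply', Matrix.det_apply']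
  refine hasLimitAtInfinity_sum _ fun σ _ => ?_
  refine HasLimitAtInfinity.mul ?_ (hasLimitAtInfinity_prod _ fun a _ => h _ _)
  simpa using HasLimitAtInfinity.const ((Equiv.Perm.sign σ : ℤ) : ℝ)

theorem MatrixHasLimitAtInfinity.det_ne_zero (h : MatrixHasLimitAtInfinity A A')
    (hdet : A'.det ≠ 0) : A.det ≠ 0 := by
  intro h0
  have := h.det
  rw [h0] at this
  exact hdet (this.unique hasLimitAtInfinity_zero)

theorem MatrixHasLimitAtInfinity.inv (h : MatrixHasLimitAtInfinity A A') (hdet : A'.det ≠ 0) :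
    MatrixHasLimitAtInfinity A⁻¹ A'⁻¹ := by
  intro a b
  rw [Matrix.inv_def, Matrix.inv_def, Matrix.smul_apply, Matrix.smul_apply, smul_eq_mul,
    smul_eq_mul, Ring.inverse_eq_inv', Ring.inverse_eq_inv', Matrix.adjugate_apply,
    Matrix.adjugate_apply]
  refine (h.det.inv hdet).mul (MatrixHasLimitAtInfinity.det fun c d => ?_)
  by_cases hc : c = b
  · subst hc
    by_cases hd : d = a
    · subst hd; simpa using hasLimitAtInfinity_one
    · simpa [hd] using hasLimitAtInfinity_zero
  · simpa [hc] using h c d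

end MatrixLimit

/-! ### Evaluation of transfer functions -/

/-- The transfer function `f` has no pole at `z`. -/
def RegularAt (z : ℂ) (f : RatFunc ℝ) : Prop :=
  Polynomial.eval₂ (algebraMap ℝ ℂ) z f.denom ≠ 0

theorem RegularAt.of_dvd {z : ℂ} {f : RatFunc ℝ} {q : Polynomial ℝ} (h : f.denom ∣ q)
    (hq : Polynomial.eval₂ (algebraMap ℝ ℂ) z q ≠ 0) : RegularAt z f := by
  obtain ⟨r, rfl⟩ := h
  rw [Polynomial.eval₂_mul] at hq
  exact left_ne_zero_of_mul hq

theorem RegularAt.add {z : ℂ} {f g : RatFunc ℝ} (hf : RegularAt z f) (hg : RegularAt z g) :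
    RegularAt z (f + g) :=
  .of_dvd (RatFunc.denom_add_dvd f g) (by rw [Polynomial.eval₂_mul]; exact mul_ne_zero hf hg)

theorem RegularAt.mul {z : ℂ} {f g : RatFunc ℝ} (hf : RegularAt z f) (hg : RegularAt z g) :
    RegularAt z (f * g) :=
  .of_dvd (RatFunc.denom_mul_dvd f g) (by rw [Polynomial.eval₂_mul]; exact mul_ne_zero hf hg)

theorem regularAt_C (z : ℂ) (r : ℝ) : RegularAt z (RatFunc.C r) := by
  simp [RegularAt]

theorem regularAt_zero (z : ℂ) : RegularAt z 0 := by
  simp [RegularAt]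

/-- `RatFunc.eval` is additive only under a no-pole condition, so regularity of partial sums and
their values go through one induction. -/
theorem regularAt_sum_and_eval {ι : Type*} (s : Finset ι) {z : ℂ} {f : ι → RatFunc ℝ}
    (h : ∀ i ∈ s, RegularAt z (f i)) : RegularAt z (∑ i ∈ s, f i) ∧
      RatFunc.eval (algebraMap ℝ ℂ) z (∑ i ∈ s, f i) =
        ∑ i ∈ s, RatFunc.eval (algebraMap ℝ ℂ) z (f i) := by
  classical
  induction s using Finset.induction_on with
  | empty => simpa using regularAt_zero z
  | insert i s hi ih =>
    obtain ⟨h1, h2⟩ := ih fun k hk => h k (Finset.mem_insert_of_mem hk)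
    have h3 := h i (Finset.mem_insert_self _ _)
    rw [Finset.sum_insert hi, Finset.sum_insert hi, RatFunc.eval_add _ _ h3 h1, h2]
    exact ⟨h3.add h1, rfl⟩

theorem IsStable.regularAt {f : RatFunc ℝ} (hf : IsStable f) {z : ℂ} (hz : 1 ≤ ‖z‖) :
    RegularAt z f := fun h => absurd (hf z h) (not_lt.2 hz)

theorem noPoleOutside_iff {f : RatFunc ℝ} :
    NoPoleOutside f ↔ ∀ z : ℂ, 1 < ‖z‖ → RegularAt z f :=
  ⟨fun h z hz h0 => absurd (h z h0) (not_le.2 hz),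
    fun h z h0 => not_lt.1 fun hz => h z hz h0⟩

section MatrixEval

variable {ι κ μ : Type*}

/-- No entry has a pole at `z`. -/
def MatrixRegularAt (z : ℂ) (A : Matrix ι κ (RatFunc ℝ)) : Prop := ∀ a b, RegularAt z (A a b)

theorem MatrixRegularAt.mul [Fintype κ] {z : ℂ} {A : Matrix ι κ (RatFunc ℝ)}
    {B : Matrix κ μ (RatFunc ℝ)} (hA : MatrixRegularAt z A) (hB : MatrixRegularAt z B) :
    MatrixRegularAt z (A * B) := fun a b =>
  (regularAt_sum_and_eval _ fun k _ => (hA a k).mul (hB k b)).1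

theorem evalAt_mul [Fintype κ] {z : ℂ} {A : Matrix ι κ (RatFunc ℝ)}
    {B : Matrix κ μ (RatFunc ℝ)} (hA : MatrixRegularAt z A) (hB : MatrixRegularAt z B) :
    evalAt z (A * B) = evalAt z A * evalAt z B := by
  ext a b
  refine (regularAt_sum_and_eval _ fun k _ => (hA a k).mul (hB k b)).2.trans ?_
  exact Finset.sum_congr rfl fun k _ => RatFunc.eval_mul _ _ (hA a k) (hB k b)

theorem matrixRegularAt_map_C (z : ℂ) (A : Matrix ι κ ℝ) :
    MatrixRegularAt z (A.map RatFunc.C) := fun _ _ => regularAt_C z _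

theorem evalAt_map_C (z : ℂ) (A : Matrix ι κ ℝ) :
    evalAt z (A.map RatFunc.C) = A.map (algebraMap ℝ ℂ) := by
  ext a b
  simp [evalAt]

theorem evalAt_one [DecidableEq ι] (z : ℂ) : evalAt z (1 : Matrix ι ι (RatFunc ℝ)) = 1 := by
  ext a b
  by_cases h : a = b <;> simp [evalAt, Matrix.one_apply, h]

end MatrixEval

/-! ### The unit circle -/

theorem norm_exp_I_mul (ω : ℝ) : ‖Complex.exp (Complex.I * ω)‖ = 1 := by
  rw [mul_comm]
  exact Complex.norm_exp_ofReal_mul_I ω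

/-- There are finitely many roots, and each is attained at countably many frequencies. Identities of
rational functions can thus be tested at almost all frequencies. -/
theorem ae_eval₂_circle_ne_zero {p : Polynomial ℝ} (hp : p ≠ 0) :
    ∀ᵐ ω : ℝ, Polynomial.eval₂ (algebraMap ℝ ℂ) (Complex.exp (Complex.I * ω)) p ≠ 0 := by
  have hp' : p.map (algebraMap ℝ ℂ) ≠ 0 :=
    (Polynomial.map_ne_zero_iff (algebraMap ℝ ℂ).injective).2 hp
  have hfib : ∀ r : ℂ, {ω : ℝ | Complex.exp (Complex.I * ω) = r}.Countable := by
    intro r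
    rcases Set.eq_empty_or_nonempty {ω : ℝ | Complex.exp (Complex.I * ω) = r} with h | ⟨ω₀, h⟩
    · rw [h]; exact Set.countable_empty
    · refine (Set.countable_range fun n : ℤ => ω₀ + n * (2 * Real.pi)).mono ?_
      intro ω hω
      obtain ⟨n, hn⟩ := Complex.exp_eq_exp_iff_exists_int.1 (Eq.trans hω (Eq.symm h))
      refine ⟨n, ?_⟩
      have h2 : Complex.I * ω = Complex.I * (ω₀ + n * (2 * Real.pi)) := by
        rw [hn]; ring
      have h3 := mul_left_cancel₀ Complex.I_ne_zero h2
      exact_mod_cast h3.symm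
  have hcount : {ω : ℝ | (p.map (algebraMap ℝ ℂ)).IsRoot
      (Complex.exp (Complex.I * ω))}.Countable := by
    have := (Polynomial.finite_setOfPred_isRoot hp').countable.biUnion
      (t := fun r _ => {ω : ℝ | Complex.exp (Complex.I * ω) = r}) fun r _ => hfib r
    refine this.mono fun ω hω => ?_
    simp only [Set.mem_iUnion]
    exact ⟨_, hω, rfl⟩
  filter_upwards [hcount.ae_notMem volume] with ω hω h0
  apply hω
  change Polynomial.eval _ _ = 0
  rw [Polynomial.eval_map]
  exact h0

theorem ae_matrixRegularAt_circle {ι κ : Type*} [Finite ι] [Finite κ]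
    (A : Matrix ι κ (RatFunc ℝ)) :
    ∀ᵐ ω : ℝ, MatrixRegularAt (Complex.exp (Complex.I * ω)) A :=
  Filter.eventually_all.2 fun a => Filter.eventually_all.2 fun b =>
    ae_eval₂_circle_ne_zero (A a b).denom_ne_zero

theorem continuous_eval₂_circle (p : Polynomial ℝ) : Continuous fun ω : ℝ =>
    Polynomial.eval₂ (algebraMap ℝ ℂ) (Complex.exp (Complex.I * ω)) p := by
  have h : Continuous fun ω : ℝ => Complex.exp (Complex.I * ω) := by fun_prop
  have := (p.map (algebraMap ℝ ℂ)).continuous.comp h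
  simpa only [Function.comp_def, Polynomial.eval_map] using this

theorem exists_exp_eq {z : ℂ} (hz : ‖z‖ = 1) : ∃ ω : ℝ, Complex.exp (Complex.I * ω) = z := by
  refine ⟨z.arg, ?_⟩
  have := Complex.norm_mul_exp_arg_mul_I z
  rw [hz] at this
  rw [mul_comm]
  simpa using this

theorem isCoprime_eval₂_ne_zero {p q : Polynomial ℝ} (h : IsCoprime p q) {z : ℂ}
    (hp : Polynomial.eval₂ (algebraMap ℝ ℂ) z p = 0)
    (hq : Polynomial.eval₂ (algebraMap ℝ ℂ) z q = 0) : False := by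
  obtain ⟨a, b, hab⟩ := h
  have := congrArg (Polynomial.eval₂ (algebraMap ℝ ℂ) z) hab
  simp [hp, hq] at this

/-- A transfer function that is bounded on the unit circle has no poles there. -/
theorem regularAt_of_ae_norm_le {f : RatFunc ℝ}
    (hf : ∀ᵐ ω : ℝ, ‖RatFunc.eval (algebraMap ℝ ℂ) (Complex.exp (Complex.I * ω)) f‖ ≤ 1)
    {z : ℂ} (hz : ‖z‖ = 1) : RegularAt z f := by
  have hle : ∀ᵐ ω : ℝ,
      ‖Polynomial.eval₂ (algebraMap ℝ ℂ) (Complex.exp (Complex.I * ω)) f.num‖ ≤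
        ‖Polynomial.eval₂ (algebraMap ℝ ℂ) (Complex.exp (Complex.I * ω)) f.denom‖ := by
    filter_upwards [hf, ae_eval₂_circle_ne_zero f.denom_ne_zero] with ω h1 h2
    rwa [RatFunc.eval, norm_div, div_le_one (norm_pos_iff.2 h2)] at h1
  -- After passing to numerator and denominator, the bound is a closed condition on a dense set and
  -- holds everywhere. At a pole the numerator would then vanish too, against coprimality.
  have hall : ∀ ω : ℝ,
      ‖Polynomial.eval₂ (algebraMap ℝ ℂ) (Complex.exp (Complex.I * ω)) f.num‖ ≤
        ‖Polynomial.eval₂ (algebraMap ℝ ℂ) (Complex.exp (Complex.I * ω)) f.denom‖ := by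
    have hclosed : IsClosed {ω : ℝ |
        ‖Polynomial.eval₂ (algebraMap ℝ ℂ) (Complex.exp (Complex.I * ω)) f.num‖ ≤
          ‖Polynomial.eval₂ (algebraMap ℝ ℂ) (Complex.exp (Complex.I * ω)) f.denom‖} :=
      isClosed_le (continuous_eval₂_circle _).norm (continuous_eval₂_circle _).norm
    intro ω
    have hd := Measure.dense_of_ae hle
    exact hclosed.closure_subset (hd ω)
  obtain ⟨ω, rfl⟩ := exists_exp_eq hz
  intro h0
  have := hall ω
  rw [h0, norm_zero, norm_le_zero_iff] at this
  exact isCoprime_eval₂_ne_zero (RatFunc.isCoprime_num_denom f) this h0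

/-- Two proper transfer functions without poles outside the closed unit disc are constant, if they
are bounded and conjugate to each other on the unit circle. -/
theorem eq_C_of_conj_on_circle {f h : RatFunc ℝ} (hfp : IsProper f) (hhp : IsProper h)
    (hfo : NoPoleOutside f) (hho : NoPoleOutside h)
    (hb : ∀ᵐ ω : ℝ, ‖RatFunc.eval (algebraMap ℝ ℂ) (Complex.exp (Complex.I * ω)) f‖ ≤ 1)
    (hc : ∀ᵐ ω : ℝ, star (RatFunc.eval (algebraMap ℝ ℂ) (Complex.exp (Complex.I * ω)) f) =
      RatFunc.eval (algebraMap ℝ ℂ) (Complex.exp (Complex.I * ω)) h) :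
    ∃ r : ℝ, h = RatFunc.C r := by
  set N := f.denom.natDegree with hN
  have hpN : f.num.natDegree ≤ N := Polynomial.natDegree_le_natDegree hfp
  -- On the circle conjugation is `z ↦ 1/z`, so the conjugate of `f` is the quotient of the
  -- reflected polynomials. This gives `h(z) = f(1/z)` as rational functions, recorded without
  -- denominators in `hid`.
  have hrefl : ∀ ω : ℝ, ∀ p : Polynomial ℝ, p.natDegree ≤ N →
      Polynomial.eval₂ (algebraMap ℝ ℂ) (Complex.exp (Complex.I * ω)) (p.reflect N) *
        star (Complex.exp (Complex.I * ω)) ^ N =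
      star (Polynomial.eval₂ (algebraMap ℝ ℂ) (Complex.exp (Complex.I * ω)) p) := by
    intro ω p hp
    set z := Complex.exp (Complex.I * ω) with hz
    have hzz : z * star z = 1 := by
      have := Complex.mul_conj z
      rw [Complex.normSq_eq_norm_sq, norm_exp_I_mul] at this
      simpa using this
    let inst : Invertible (star z) := ⟨z, hzz, by rw [mul_comm]; exact hzz⟩
    have h1 := Polynomial.eval₂_reflect_mul_pow (algebraMap ℝ ℂ) (star z) N p hp
    rw [show ⅟(star z) = z from rfl] at h1
    rw [h1]
    have h2 := Polynomial.hom_eval₂ p (algebraMap ℝ ℂ) (starRingEnd ℂ) z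
    rw [show (starRingEnd ℂ).comp (algebraMap ℝ ℂ) = algebraMap ℝ ℂ by
      ext r; simp] at h2
    exact h2.symm
  have hid : f.num.reflect N * h.denom = h.num * f.denom.reflect N := by
    by_contra hne
    have hae := ae_eval₂_circle_ne_zero (sub_ne_zero.2 hne)
    obtain ⟨ω, h1, h2, h3, h4⟩ := (hae.and (hc.and ((ae_eval₂_circle_ne_zero
      f.denom_ne_zero).and (ae_eval₂_circle_ne_zero h.denom_ne_zero)))).exists
    apply h1
    rw [Polynomial.eval₂_sub, Polynomial.eval₂_mul, Polynomial.eval₂_mul, sub_eq_zero]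
    have h5 := hrefl ω f.num hpN
    have h6 := hrefl ω f.denom le_rfl
    have h7 : star (Complex.exp (Complex.I * ω)) ^ N ≠ 0 :=
      pow_ne_zero _ (star_ne_zero.2 (Complex.exp_ne_zero _))
    simp only [RatFunc.eval, star_div₀] at h2
    rw [div_eq_div_iff (star_ne_zero.2 h3) h4, ← h5, ← h6] at h2
    apply mul_right_cancel₀ h7
    linear_combination h2
  have hdvd : h.denom ∣ f.denom.reflect N :=
    (RatFunc.isCoprime_num_denom h).symm.dvd_of_dvd_mul_left ⟨_, by rw [← hid, mul_comm]⟩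
  have hnoroot : ∀ z : ℂ, Polynomial.eval₂ (algebraMap ℝ ℂ) z h.denom ≠ 0 := by
    intro z hz
    have hz1 : ‖z‖ ≤ 1 := hho z hz
    obtain ⟨r, hr⟩ := hdvd
    have h1 : Polynomial.eval₂ (algebraMap ℝ ℂ) z (f.denom.reflect N) = 0 := by
      rw [hr, Polynomial.eval₂_mul, hz, zero_mul]
    -- The reflection at `0` is the leading coefficient of `f.denom`, hence nonzero. Any other root
    -- `z` makes `1/z` a pole of `f`, so both have modulus at most one. They lie on the circle,
    -- where `f` is bounded.
    by_cases hz0 : z = 0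
    · rw [hz0, Polynomial.eval₂_at_zero, Polynomial.coeff_reflect, Polynomial.revAt_le (Nat.zero_le _)] at h1
      simp [hN, f.denom_ne_zero] at h1
    · let inst : Invertible z⁻¹ := ⟨z, mul_inv_cancel₀ hz0, inv_mul_cancel₀ hz0⟩
      have h2 := Polynomial.eval₂_reflect_mul_pow (algebraMap ℝ ℂ) z⁻¹ N f.denom le_rfl
      rw [show ⅟z⁻¹ = z from rfl, h1, zero_mul] at h2
      have h3 : ‖z⁻¹‖ ≤ 1 := hfo z⁻¹ h2.symm
      have h4 : ‖z⁻¹‖ = 1 := by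
        refine le_antisymm h3 ?_
        rw [norm_inv]
        exact (one_le_inv₀ (norm_pos_iff.2 hz0)).2 hz1
      exact regularAt_of_ae_norm_le hb h4 h2.symm
  have hdeg : h.denom.natDegree = 0 := by
    by_contra hne
    have hne' : (h.denom.map (algebraMap ℝ ℂ)).degree ≠ 0 := by
      rw [Polynomial.degree_map]
      intro h0
      exact hne (Polynomial.natDegree_eq_of_degree_eq_some h0)
    obtain ⟨z, hz⟩ := IsAlgClosed.exists_root _ hne'
    refine hnoroot z ?_
    rw [← Polynomial.eval_map]
    exact hz
  have hden : h.denom = 1 := by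
    rw [Polynomial.eq_C_of_natDegree_eq_zero hdeg]
    have := h.monic_denom
    rw [Polynomial.Monic, Polynomial.leadingCoeff, hdeg] at this
    rw [this, Polynomial.C_1]
  have hnum : h.num.natDegree = 0 := by
    have := Polynomial.natDegree_le_natDegree hhp
    omega
  refine ⟨h.num.coeff 0, ?_⟩
  have := RatFunc.num_div_denom h
  rw [hden, map_one, div_one, Polynomial.eq_C_of_natDegree_eq_zero hnum] at this
  rw [← this, RatFunc.algebraMap_C]
  simp

/-! ### Uniqueness of spectral factors -/

section SpectralFactor

open scoped MatrixOrder ComplexOrder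

variable {ι : Type*} [Fintype ι] [DecidableEq ι]

/-- A transfer matrix that is unitary on the unit circle is constant, if it is proper without poles
outside the closed unit disc, together with its inverse. -/
theorem eq_map_C_of_unitary_on_circle {P P' : Matrix ι ι (RatFunc ℝ)} (hPP' : P * P' = 1)
    (hp : ∀ a b, IsProper (P a b)) (hp' : ∀ a b, IsProper (P' a b))
    (ho : ∀ a b, NoPoleOutside (P a b)) (ho' : ∀ a b, NoPoleOutside (P' a b))
    (hu : ∀ᵐ ω : ℝ, evalAt (Complex.exp (Complex.I * ω)) P *
      (evalAt (Complex.exp (Complex.I * ω)) P)ᴴ = 1) :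
    ∃ O : Matrix ι ι ℝ, P = O.map RatFunc.C := by
  have hu' : ∀ᵐ ω : ℝ, evalAt (Complex.exp (Complex.I * ω)) P' =
      (evalAt (Complex.exp (Complex.I * ω)) P)ᴴ := by
    filter_upwards [hu, ae_matrixRegularAt_circle P, ae_matrixRegularAt_circle P'] with ω h1 h2 h3
    have h4 := evalAt_mul h2 h3
    rw [hPP', evalAt_one] at h4
    have h5 := mul_eq_one_comm.1 h1
    calc evalAt (Complex.exp (Complex.I * ω)) P' = ((evalAt (Complex.exp (Complex.I * ω)) P)ᴴ *
          evalAt (Complex.exp (Complex.I * ω)) P) * evalAt (Complex.exp (Complex.I * ω)) P' := by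
          rw [h5, Matrix.one_mul]
      _ = _ := by rw [Matrix.mul_assoc, ← h4, Matrix.mul_one]
  have key : ∀ a b, ∃ r : ℝ, P a b = RatFunc.C r := by
    intro a b
    -- The inverse is the conjugate transpose on the circle, so the entry `(a, b)` of `P` is
    -- conjugate to the entry `(b, a)` of `P'`. Unitarity bounds both by one.
    refine eq_C_of_conj_on_circle (hp' b a) (hp a b) (ho' b a) (ho a b) ?_ ?_
    · filter_upwards [hu, hu'] with ω h1 h2
      have h3 : evalAt (Complex.exp (Complex.I * ω)) P' ∈ Matrix.unitaryGroup ι ℂ := by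
        rw [Matrix.mem_unitaryGroup_iff, Matrix.star_eq_conjTranspose, h2,
          Matrix.conjTranspose_conjTranspose]
        exact mul_eq_one_comm.1 h1
      exact entry_norm_bound_of_unitary h3 b a
    · filter_upwards [hu'] with ω h
      have := congrFun (congrFun h b) a
      simp only [evalAt, Matrix.map_apply, Matrix.conjTranspose_apply] at this
      rw [this, star_star]
  choose O hO using key
  exact ⟨Matrix.of O, by ext a b; simp [hO]⟩

theorem exists_mul_conjTranspose_eq {Λ : Matrix ι ι ℝ} (h : Λ.PosDef) :
    ∃ B : Matrix ι ι ℝ, Λ = B * Bᴴ ∧ B.det ≠ 0 := by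
  obtain ⟨y, hy⟩ := CStarAlgebra.nonneg_iff_eq_star_mul_self.mp h.posSemidef.nonneg
  refine ⟨yᴴ, by rw [hy, Matrix.star_eq_conjTranspose, Matrix.conjTranspose_conjTranspose], ?_⟩
  intro h0
  have := h.det_pos
  rw [hy, Matrix.det_mul, Matrix.star_eq_conjTranspose, h0, zero_mul] at this
  exact lt_irrefl _ this

theorem map_algebraMap_conjTranspose {κ : Type*} (B : Matrix κ κ ℝ) :
    Bᴴ.map (algebraMap ℝ ℂ) = (B.map (algebraMap ℝ ℂ))ᴴ := by
  ext a b
  simp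

theorem matrix_map_mul_inv {S : Type*} [CommRing S] (f : ℝ →+* S) {B : Matrix ι ι ℝ}
    (hB : B.det ≠ 0) : B.map f * B⁻¹.map f = 1 := by
  rw [← Matrix.map_mul, Matrix.mul_nonsing_inv _ (isUnit_iff_ne_zero.2 hB)]
  simp

theorem unitary_aux {U X F₀ F₁ B₀ B₁ B₁' : Matrix ι ι ℂ} (hX : X * F₁ = 1) (hB : B₁' * B₁ = 1)
    (hU : U = B₁' * (X * (F₀ * B₀)))
    (h : F₀ * (B₀ * B₀ᴴ) * F₀ᴴ = F₁ * (B₁ * B₁ᴴ) * F₁ᴴ) : U * Uᴴ = 1 := by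
  have hX' : F₁ᴴ * Xᴴ = 1 := by
    rw [← Matrix.conjTranspose_mul, hX, Matrix.conjTranspose_one]
  have hB' : B₁ᴴ * B₁'ᴴ = 1 := by
    rw [← Matrix.conjTranspose_mul, hB, Matrix.conjTranspose_one]
  calc U * Uᴴ = B₁' * (X * (F₀ * (B₀ * B₀ᴴ) * F₀ᴴ) * Xᴴ) * B₁'ᴴ := by
        rw [hU]
        simp only [Matrix.conjTranspose_mul, Matrix.mul_assoc]
    _ = B₁' * ((X * F₁) * (B₁ * B₁ᴴ) * (F₁ᴴ * Xᴴ)) * B₁'ᴴ := by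
        rw [h]
        simp only [Matrix.mul_assoc]
    _ = (B₁' * B₁) * (B₁ᴴ * B₁'ᴴ) := by
        rw [hX, hX', Matrix.one_mul, Matrix.mul_one]
        simp only [Matrix.mul_assoc]
    _ = 1 := by rw [hB, hB', Matrix.one_mul]

/-- Stable, minimum phase and biproper spectral factors are unique up to a constant matrix. -/
theorem exists_eq_mul_map_C_of_spectrum_eq {F₀ F₁ : Matrix ι ι (RatFunc ℝ)}
    {E₀ E₁ Λ₀ Λ₁ : Matrix ι ι ℝ}
    (hE₀ : MatrixHasLimitAtInfinity F₀ E₀) (hE₁ : MatrixHasLimitAtInfinity F₁ E₁)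
    (hd₀ : E₀.det ≠ 0) (hd₁ : E₁.det ≠ 0)
    (hs₀ : ∀ z : ℂ, 1 ≤ ‖z‖ → MatrixRegularAt z F₀)
    (hs₁ : ∀ z : ℂ, 1 ≤ ‖z‖ → MatrixRegularAt z F₁)
    (hm₀ : IsMinimumPhase F₀) (hm₁ : IsMinimumPhase F₁) (hΛ₀ : Λ₀.PosDef) (hΛ₁ : Λ₁.PosDef)
    (h : ∀ ω : ℝ, evalAt (Complex.exp (Complex.I * ω)) F₀ * Λ₀.map (algebraMap ℝ ℂ) *
        (evalAt (Complex.exp (Complex.I * ω)) F₀)ᴴ =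
      evalAt (Complex.exp (Complex.I * ω)) F₁ * Λ₁.map (algebraMap ℝ ℂ) *
        (evalAt (Complex.exp (Complex.I * ω)) F₁)ᴴ) :
    ∃ Q : Matrix ι ι ℝ, F₀ = F₁ * Q.map RatFunc.C ∧ Q * Λ₀ * Qᴴ = Λ₁ := by
  obtain ⟨B₀, hB₀, hb₀⟩ := exists_mul_conjTranspose_eq hΛ₀
  obtain ⟨B₁, hB₁, hb₁⟩ := exists_mul_conjTranspose_eq hΛ₁
  have hF₀ : F₀ * F₀⁻¹ = 1 := Matrix.mul_nonsing_inv _ (isUnit_iff_ne_zero.2 hm₀.1)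
  have hF₁ : F₁ * F₁⁻¹ = 1 := Matrix.mul_nonsing_inv _ (isUnit_iff_ne_zero.2 hm₁.1)
  have hF₁' : F₁⁻¹ * F₁ = 1 := Matrix.nonsing_inv_mul _ (isUnit_iff_ne_zero.2 hm₁.1)
  have hbC₀ := matrix_map_mul_inv (RatFunc.C (K := ℝ)) hb₀
  have hbC₁ := matrix_map_mul_inv (RatFunc.C (K := ℝ)) hb₁
  have hbC₁' := mul_eq_one_comm.1 hbC₁
  have hbℂ₁ := mul_eq_one_comm.1 (matrix_map_mul_inv (algebraMap ℝ ℂ) hb₁)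
  -- generic points of the unit circle
  have hinv : ∀ᵐ ω : ℝ, evalAt (Complex.exp (Complex.I * ω)) F₁⁻¹ *
      evalAt (Complex.exp (Complex.I * ω)) F₁ = 1 := by
    filter_upwards [ae_matrixRegularAt_circle F₁⁻¹] with ω hω
    rw [← evalAt_mul hω (hs₁ _ (norm_exp_I_mul ω).ge), hF₁', evalAt_one]
  have hlim := (matrixHasLimitAtInfinity_map_C B₁⁻¹).mul ((hE₁.inv hd₁).mul
    (hE₀.mul (matrixHasLimitAtInfinity_map_C B₀)))
  have hlim' := (matrixHasLimitAtInfinity_map_C B₀⁻¹).mul ((hE₀.inv hd₀).mul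
    (hE₁.mul (matrixHasLimitAtInfinity_map_C B₁)))
  obtain ⟨O, hO⟩ := eq_map_C_of_unitary_on_circle
    (P := B₁⁻¹.map RatFunc.C * (F₁⁻¹ * (F₀ * B₀.map RatFunc.C)))
    (P' := B₀⁻¹.map RatFunc.C * (F₀⁻¹ * (F₁ * B₁.map RatFunc.C))) (by
      calc _ = B₁⁻¹.map RatFunc.C * (F₁⁻¹ * (F₀ * (B₀.map RatFunc.C * B₀⁻¹.map RatFunc.C) * F₀⁻¹) *
            (F₁ * B₁.map RatFunc.C)) := by simp only [Matrix.mul_assoc]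
        _ = B₁⁻¹.map RatFunc.C * ((F₁⁻¹ * F₁) * B₁.map RatFunc.C) := by
            rw [hbC₀, Matrix.mul_one, hF₀, Matrix.mul_one]
            simp only [Matrix.mul_assoc]
        _ = 1 := by rw [hF₁', Matrix.one_mul, hbC₁'])
    (fun a b => (hlim a b).isProper) (fun a b => (hlim' a b).isProper)
    (fun a b => noPoleOutside_iff.2 fun z hz =>
      ((matrixRegularAt_map_C z _).mul (MatrixRegularAt.mul
        (fun c d => noPoleOutside_iff.1 (hm₁.2 c d) z hz)
        ((hs₀ z hz.le).mul (matrixRegularAt_map_C z _)))) a b)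
    (fun a b => noPoleOutside_iff.2 fun z hz =>
      ((matrixRegularAt_map_C z _).mul (MatrixRegularAt.mul
        (fun c d => noPoleOutside_iff.1 (hm₀.2 c d) z hz)
        ((hs₁ z hz.le).mul (matrixRegularAt_map_C z _)))) a b) (by
      filter_upwards [hinv, ae_matrixRegularAt_circle F₁⁻¹] with ω h1 h2
      have h3 := hs₀ _ (norm_exp_I_mul ω).ge
      refine unitary_aux h1 hbℂ₁ (B₀ := B₀.map (algebraMap ℝ ℂ))
        (F₀ := evalAt (Complex.exp (Complex.I * ω)) F₀) ?_ ?_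
      · rw [evalAt_mul (matrixRegularAt_map_C _ _) (h2.mul (h3.mul (matrixRegularAt_map_C _ _))),
          evalAt_mul h2 (h3.mul (matrixRegularAt_map_C _ _)),
          evalAt_mul h3 (matrixRegularAt_map_C _ _), evalAt_map_C, evalAt_map_C]
      · have h4 := h ω
        rw [hB₀, hB₁, Matrix.map_mul, Matrix.map_mul, map_algebraMap_conjTranspose,
          map_algebraMap_conjTranspose] at h4
        exact h4)
  have hQ : F₀ = F₁ * (B₁ * O * B₀⁻¹).map RatFunc.C := by
    rw [Matrix.map_mul, Matrix.map_mul, ← hO]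
    calc F₀ = (F₁ * F₁⁻¹) * F₀ * (B₀.map RatFunc.C * B₀⁻¹.map RatFunc.C) := by
          rw [hbC₀, hF₁, Matrix.one_mul, Matrix.mul_one]
      _ = F₁ * ((B₁.map RatFunc.C * B₁⁻¹.map RatFunc.C) * (F₁⁻¹ * (F₀ * B₀.map RatFunc.C)) *
            B₀⁻¹.map RatFunc.C) := by
          rw [hbC₁, Matrix.one_mul]
          simp only [Matrix.mul_assoc]
      _ = _ := by simp only [Matrix.mul_assoc]
  refine ⟨B₁ * O * B₀⁻¹, hQ, ?_⟩
  -- The relation between the covariances has no frequency in it, so one point where `F₁` can be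
  -- cancelled suffices.
  obtain ⟨ω, hω⟩ := hinv.exists
  set Q := B₁ * O * B₀⁻¹
  have h1 := h ω
  rw [hQ, evalAt_mul (hs₁ _ (norm_exp_I_mul ω).ge) (matrixRegularAt_map_C _ _), evalAt_map_C] at h1
  set z := Complex.exp (Complex.I * ω)
  have h2 : (evalAt z F₁)ᴴ * (evalAt z F₁⁻¹)ᴴ = 1 := by
    rw [← Matrix.conjTranspose_mul, hω, Matrix.conjTranspose_one]
  have h3 : (Q * Λ₀ * Qᴴ).map (algebraMap ℝ ℂ) = Λ₁.map (algebraMap ℝ ℂ) := by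
    have h4 := congrArg (fun Y => evalAt z F₁⁻¹ * Y * (evalAt z F₁⁻¹)ᴴ) h1
    rw [Matrix.map_mul, Matrix.map_mul, map_algebraMap_conjTranspose]
    calc _ = (evalAt z F₁⁻¹ * evalAt z F₁) * (Q.map (algebraMap ℝ ℂ) * Λ₀.map (algebraMap ℝ ℂ) *
          (Q.map (algebraMap ℝ ℂ))ᴴ) * ((evalAt z F₁)ᴴ * (evalAt z F₁⁻¹)ᴴ) := by
          rw [hω, h2, Matrix.one_mul, Matrix.mul_one]
      _ = evalAt z F₁⁻¹ * (evalAt z F₁ * Q.map (algebraMap ℝ ℂ) * Λ₀.map (algebraMap ℝ ℂ) *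
          (evalAt z F₁ * Q.map (algebraMap ℝ ℂ))ᴴ) * (evalAt z F₁⁻¹)ᴴ := by
          simp only [Matrix.conjTranspose_mul, Matrix.mul_assoc]
      _ = (evalAt z F₁⁻¹ * evalAt z F₁) * Λ₁.map (algebraMap ℝ ℂ) *
          ((evalAt z F₁)ᴴ * (evalAt z F₁⁻¹)ᴴ) := by
          rw [h4]
          simp only [Matrix.mul_assoc]
      _ = _ := by rw [hω, h2, Matrix.one_mul, Matrix.mul_one]
  exact Matrix.map_injective (algebraMap ℝ ℂ).injective h3

end SpectralFactor

/-! ### Unit triangular matrices -/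

section Triangular

variable {ι α : Type*} [Fintype ι] [LinearOrder α] {b : ι → α}

theorem BlockTriangular.mul_diag (hb : Function.Injective b) {A B : Matrix ι ι ℝ}
    (hA : A.BlockTriangular b) (hB : B.BlockTriangular b) (a : ι) :
    (A * B) a a = A a a * B a a := by
  rw [Matrix.mul_apply]
  refine Finset.sum_eq_single a (fun c _ hc => ?_) (by simp)
  rcases lt_or_gt_of_ne (hb.ne hc) with h | h
  · rw [hA h, zero_mul]
  · rw [hB h, mul_zero]

variable [DecidableEq ι]

theorem BlockTriangular.inv' {A : Matrix ι ι ℝ} (hA : A.BlockTriangular b) (hdet : A.det ≠ 0) :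
    A⁻¹.BlockTriangular b := by
  have : Invertible A := Matrix.invertibleOfIsUnitDet A (isUnit_iff_ne_zero.2 hdet)
  exact Matrix.blockTriangular_inv_of_blockTriangular hA

theorem BlockTriangular.inv_diag (hb : Function.Injective b) {A : Matrix ι ι ℝ}
    (hA : A.BlockTriangular b) (hdet : A.det ≠ 0) (hdiag : ∀ a, A a a = 1) (a : ι) :
    A⁻¹ a a = 1 := by
  have h := BlockTriangular.mul_diag hb hA (BlockTriangular.inv' hA hdet) a
  rw [Matrix.mul_nonsing_inv _ (isUnit_iff_ne_zero.2 hdet), Matrix.one_apply_eq, hdiag,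
    one_mul] at h
  exact h.symm

/-- A unit triangular matrix that transforms a nonsingular diagonal matrix into a diagonal matrix is
the identity. -/
theorem BlockTriangular.eq_one_of_isDiag (hb : Function.Injective b) {Q Λ₀ Λ₁ : Matrix ι ι ℝ}
    (hQ : Q.BlockTriangular b) (hdet : Q.det ≠ 0) (hdiag : ∀ a, Q a a = 1)
    (h₀ : Λ₀.IsDiag) (h₁ : Λ₁.IsDiag) (hpos : ∀ a, Λ₀ a a ≠ 0) (h : Q * Λ₀ * Qᴴ = Λ₁) :
    Q = 1 := by
  -- The two sides are triangular in opposite directions because `Λ₀` and `Λ₁` are diagonal. The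
  -- off-diagonal entries that triangularity of `Q` leaves open are therefore zero.
  have h2 : Q * Λ₀ = Λ₁ * Q⁻¹ᴴ := by
    rw [← h, Matrix.mul_assoc _ Qᴴ, Matrix.conjTranspose_nonsing_inv,
      Matrix.mul_nonsing_inv _ (by simpa [Matrix.det_conjTranspose] using hdet), Matrix.mul_one]
  ext a c
  by_cases hac : a = c
  · subst hac; rw [hdiag, Matrix.one_apply_eq]
  rw [Matrix.one_apply_ne hac]
  rcases lt_or_gt_of_ne (hb.ne hac) with hlt | hlt
  · have h3 := congrFun (congrFun h2 a) c
    rw [Matrix.mul_apply, Matrix.mul_apply, Finset.sum_eq_single c, Finset.sum_eq_single a,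
      Matrix.conjTranspose_apply, BlockTriangular.inv' hQ hdet hlt, star_zero, mul_zero] at h3
    · exact (mul_eq_zero.1 h3).resolve_right (hpos c)
    · intro d _ hd
      rw [h₁ (Ne.symm hd), zero_mul]
    · simp
    · intro d _ hd
      rw [h₀ hd, mul_zero]
    · simp
  · exact hQ hlt

end Triangular

theorem BlockTriangular.det_ne_zero {ι α : Type*} [Fintype ι] [DecidableEq ι] [LinearOrder α]
    {b : ι → α} (hb : Function.Injective b) {A : Matrix ι ι ℝ} (hA : A.BlockTriangular b)
    (hdiag : ∀ a, A a a = 1) : A.det ≠ 0 := by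
  let inst : LinearOrder ι := LinearOrder.lift' b hb
  have h : A.IsUpperTriangular := fun i j hij => hA hij
  rw [Matrix.det_of_isUpperTriangular h]
  simp [hdiag]

namespace NetworkModelSet

variable {L K n : ℕ} (M : NetworkModelSet L K n)

/-! ### The noise response is determined by the spectrum -/

/-- The limit of the response of the measured signals to the noise at infinity. -/
noncomputable def noiseFeedthrough (θ : Fin n → ℝ) : Matrix M.C M.C ℝ :=
  (1 - M.Ginf θ)⁻¹.submatrix Subtype.val Subtype.val

variable {M} {θ θ₀ θ₁ : Fin n → ℝ}

theorem IsRegularAt.limit_one_sub_G (h : M.IsRegularAt θ) :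
    MatrixHasLimitAtInfinity (1 - M.G θ) (1 - M.Ginf θ) := by
  intro a b
  refine HasLimitAtInfinity.sub ?_ (h.G_proper a b).hasLimitAtInfinity
  by_cases hab : a = b
  · subst hab; simpa using hasLimitAtInfinity_one
  · simpa [hab] using hasLimitAtInfinity_zero

/-- Principal submatrices of `I - G` are nonsingular. -/
theorem IsRegularAt.det_submatrix_ne_zero (h : M.IsRegularAt θ) (S : Finset (Fin L)) :
    ((1 - M.G θ).submatrix (Subtype.val : S → Fin L) (Subtype.val : S → Fin L)).det ≠ 0 :=
  (h.limit_one_sub_G.submatrix _ _).det_ne_zero (h.wellPosed S)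

theorem IsRegularAt.det_one_sub_Ginf_ne_zero (h : M.IsRegularAt θ) :
    (1 - M.Ginf θ).det ≠ 0 := by
  have := h.wellPosed Finset.univ
  rwa [← Matrix.det_submatrix_equiv_self (Equiv.subtypeUnivEquiv (p := (· ∈ Finset.univ))
    Finset.mem_univ) (1 - M.Ginf θ)]

theorem IsRegularAt.isUnit_det (h : M.IsRegularAt θ) : IsUnit (1 - M.G θ).det :=
  isUnit_iff_ne_zero.2 (h.limit_one_sub_G.det_ne_zero h.det_one_sub_Ginf_ne_zero)

theorem IsRegularAt.limit_T (h : M.IsRegularAt θ) :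
    MatrixHasLimitAtInfinity (M.T θ) (1 - M.Ginf θ)⁻¹ :=
  h.limit_one_sub_G.inv h.det_one_sub_Ginf_ne_zero

/-- The limit at infinity of the noise response. -/
theorem IsRegularAt.limit_noiseResponse (h : M.IsRegularAt θ) (hm : M.IsMonicMinimumPhaseAt θ) :
    MatrixHasLimitAtInfinity (M.measuredRows (M.T θ * M.Hfull θ)) (M.noiseFeedthrough θ) := by
  have hH : MatrixHasLimitAtInfinity (M.Hfull θ)
      (Matrix.of fun (a : Fin L) (c : M.C) => if a = c then (1 : ℝ) else 0) := by
    intro a c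
    by_cases ha : a ∈ M.C
    · have h1 := (h.H_proper ⟨a, ha⟩ c).hasLimitAtInfinity
      have h2 := congrFun (congrFun hm.1 ⟨a, ha⟩) c
      rw [Matrix.map_apply] at h2
      rw [h2] at h1
      convert h1 using 1
      · simp [Hfull, ha]
      · simp [Matrix.one_apply, Subtype.ext_iff]
    · have hac : a ≠ c := by rintro rfl; exact ha c.2
      simpa [Hfull, ha, hac] using hasLimitAtInfinity_zero
  have := (h.limit_T.mul hH).submatrix (Subtype.val : M.C → Fin L) id
  have he : M.noiseFeedthrough θ =
      ((1 - M.Ginf θ)⁻¹ * Matrix.of fun (a : Fin L) (c : M.C) =>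
        if a = c then (1 : ℝ) else 0).submatrix (Subtype.val : M.C → Fin L) id := by
    ext a c
    simp [Matrix.mul_apply, noiseFeedthrough]
  rw [he]
  exact this

theorem IsRegularAt.matrixRegularAt_T (h : M.IsRegularAt θ) {z : ℂ} (hz : 1 ≤ ‖z‖) :
    MatrixRegularAt z (M.T θ) := fun a b => (h.T_stable a b).regularAt hz

theorem IsRegularAt.matrixRegularAt_Hfull (h : M.IsRegularAt θ) {z : ℂ} (hz : 1 ≤ ‖z‖) :
    MatrixRegularAt z (M.Hfull θ) := by
  intro a c
  by_cases ha : a ∈ M.C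
  · simpa [Hfull, ha] using (h.H_stable ⟨a, ha⟩ c).regularAt hz
  · simpa [Hfull, ha] using regularAt_zero z

theorem IsRegularAt.matrixRegularAt_noiseResponse (h : M.IsRegularAt θ) {z : ℂ} (hz : 1 ≤ ‖z‖) :
    MatrixRegularAt z (M.measuredRows (M.T θ * M.Hfull θ)) := fun a b =>
  ((h.matrixRegularAt_T hz).mul (h.matrixRegularAt_Hfull hz)) a b

theorem IsRegularAt.measuredSpectrum_eq (h : M.IsRegularAt θ) (ω : ℝ) :
    M.measuredSpectrum θ ω =
      evalAt (Complex.exp (Complex.I * ω)) (M.measuredRows (M.T θ * M.Hfull θ)) *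
        (M.Λ θ).map (algebraMap ℝ ℂ) *
        (evalAt (Complex.exp (Complex.I * ω)) (M.measuredRows (M.T θ * M.Hfull θ)))ᴴ := by
  have hz := (norm_exp_I_mul ω).ge
  have h1 : evalAt (Complex.exp (Complex.I * ω)) (M.measuredRows (M.T θ * M.Hfull θ)) =
      (evalAt (Complex.exp (Complex.I * ω)) (M.T θ) *
        evalAt (Complex.exp (Complex.I * ω)) (M.Hfull θ)).submatrix Subtype.val id := by
    rw [← evalAt_mul (h.matrixRegularAt_T hz) (h.matrixRegularAt_Hfull hz)]
    rfl
  rw [h1, measuredSpectrum, Φ, Matrix.mul_assoc _ _ (evalAt _ (M.T θ))ᴴ,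
    ← Matrix.conjTranspose_mul]
  rfl

/-- A singular covariance would make the spectrum singular at every frequency. -/
theorem IsRegularAt.Λ_posDef (h : M.IsRegularAt θ)
    (hs : ∀ᵐ ω : ℝ, (M.measuredSpectrum θ ω).rank = M.C.card) : (M.Λ θ).PosDef := by
  rw [h.Λ_posSemidef.posDef_iff_det_ne_zero]
  intro h0
  obtain ⟨ω, hω⟩ := hs.exists
  have h1 : (M.measuredSpectrum θ ω).det = 0 := by
    rw [h.measuredSpectrum_eq, Matrix.det_mul, Matrix.det_mul, ← RingHom.mapMatrix_apply,
      ← RingHom.map_det, h0]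
    simp
  obtain ⟨v, hv, hv'⟩ := Matrix.exists_mulVec_eq_zero_iff.2 h1
  have h2 := LinearMap.finrank_range_add_finrank_ker (M.measuredSpectrum θ ω).mulVecLin
  rw [Matrix.rank] at hω
  rw [hω, Module.finrank_pi, Fintype.card_coe, Nat.add_eq_left,
    Submodule.finrank_eq_zero] at h2
  have h3 : v ∈ LinearMap.ker (M.measuredSpectrum θ ω).mulVecLin := by simpa using hv'
  rw [h2] at h3
  exact hv (by simpa using h3)

theorem IsRegularAt.limit_diag (h : M.IsRegularAt θ) (a : Fin L) : (1 - M.Ginf θ) a a = 1 := by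
  have : M.Ginf θ a a = 0 := by
    rw [Ginf, Matrix.map_apply, h.G_hollow a]
    exact hasLimitAtInfinity_zero.feedthrough_eq
  simp [this]

/-- The response of the measured signals to the noise is determined by their power spectrum. -/
theorem noiseResponse_eq (hreg : ∀ θ ∈ M.Θ, M.IsRegularAt θ)
    (hmonic : ∀ θ ∈ M.Θ, M.IsMonicMinimumPhaseAt θ)
    (hfactor : ∀ θ ∈ M.Θ, M.IsNoiseResponseMinimumPhaseAt θ)
    (hspec : M.HasFullRankSpectrum) (hfeed : M.HasFeedthroughCondition)
    (h₀ : θ₀ ∈ M.Θ) (h₁ : θ₁ ∈ M.Θ)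
    (h : ∀ ω : ℝ, M.measuredSpectrum θ₀ ω = M.measuredSpectrum θ₁ ω) :
    M.measuredRows (M.T θ₀ * M.Hfull θ₀) = M.measuredRows (M.T θ₁ * M.Hfull θ₁) := by
  -- it suffices to show that the two factors differ by the identity
  have key : (∀ θ ∈ M.Θ, (M.noiseFeedthrough θ).det ≠ 0) →
      (∀ Q : Matrix M.C M.C ℝ, M.noiseFeedthrough θ₀ = M.noiseFeedthrough θ₁ * Q →
        Q * M.Λ θ₀ * Qᴴ = M.Λ θ₁ → Q = 1) →
      M.measuredRows (M.T θ₀ * M.Hfull θ₀) = M.measuredRows (M.T θ₁ * M.Hfull θ₁) := by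
    intro hdet hQ
    have hlim : ∀ θ ∈ M.Θ, MatrixHasLimitAtInfinity (M.measuredRows (M.T θ * M.Hfull θ))
        (M.noiseFeedthrough θ) :=
      fun θ hθ => (hreg θ hθ).limit_noiseResponse (hmonic θ hθ)
    obtain ⟨Q, h1, h2⟩ := exists_eq_mul_map_C_of_spectrum_eq (hlim θ₀ h₀) (hlim θ₁ h₁)
      (hdet θ₀ h₀) (hdet θ₁ h₁) (fun z hz => (hreg θ₀ h₀).matrixRegularAt_noiseResponse hz)
      (fun z hz => (hreg θ₁ h₁).matrixRegularAt_noiseResponse hz) (hfactor θ₀ h₀) (hfactor θ₁ h₁)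
      ((hreg θ₀ h₀).Λ_posDef (hspec θ₀ h₀)) ((hreg θ₁ h₁).Λ_posDef (hspec θ₁ h₁))
      (fun ω => by
        rw [← (hreg θ₀ h₀).measuredSpectrum_eq, ← (hreg θ₁ h₁).measuredSpectrum_eq, h ω])
    have h3 := (hlim θ₁ h₁).mul (matrixHasLimitAtInfinity_map_C Q)
    rw [← h1] at h3
    rw [h1, hQ Q ((hlim θ₀ h₀).unique h3) h2]
    simp
  rcases hfeed with hstrict | ⟨hdiag, σ, hσ⟩
  · have hE : ∀ θ ∈ M.Θ, M.noiseFeedthrough θ = 1 := by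
      intro θ hθ
      have h0 : M.Ginf θ = 0 := by
        ext a b
        simp [Ginf, feedthrough, Polynomial.coeff_eq_zero_of_degree_lt
          ((hstrict θ hθ a b).trans_le Polynomial.degree_le_natDegree)]
      rw [noiseFeedthrough, h0, sub_zero, inv_one]
      exact Matrix.submatrix_one _ Subtype.val_injective
    refine key (fun θ hθ => ?_) fun Q hQ _ => ?_
    · rw [hE θ hθ]; simp
    · rw [hE θ₀ h₀, hE θ₁ h₁, Matrix.one_mul] at hQ
      exact hQ.symm
  -- The order is reversed because `BlockTriangular` means upper triangular, whereas the feedthrough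
  -- of `G` is lower triangular.
  · let b : Fin L → (Fin L)ᵒᵈ := fun a => OrderDual.toDual (σ a)
    have hb : Function.Injective b := fun a c h => σ.injective (OrderDual.toDual.injective h)
    have hbC : Function.Injective (b ∘ (Subtype.val : M.C → Fin L)) :=
      hb.comp Subtype.val_injective
    have htri : ∀ θ ∈ M.Θ, (1 - M.Ginf θ).BlockTriangular b := by
      intro θ hθ a c hac
      have h1 : σ a < σ c := hac
      have h2 : a ≠ c := by rintro rfl; exact lt_irrefl _ h1
      simp [h2, hσ θ hθ a c h1]
    have hE : ∀ θ ∈ M.Θ, (M.noiseFeedthrough θ).BlockTriangular (b ∘ Subtype.val) := fun θ hθ =>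
      (BlockTriangular.inv' (htri θ hθ) (hreg θ hθ).det_one_sub_Ginf_ne_zero).submatrix
    have hE1 : ∀ θ ∈ M.Θ, ∀ c, M.noiseFeedthrough θ c c = 1 := fun θ hθ c =>
      BlockTriangular.inv_diag hb (htri θ hθ) (hreg θ hθ).det_one_sub_Ginf_ne_zero
        (hreg θ hθ).limit_diag c
    have hdet : ∀ θ ∈ M.Θ, (M.noiseFeedthrough θ).det ≠ 0 := fun θ hθ =>
      BlockTriangular.det_ne_zero hbC (hE θ hθ) (hE1 θ hθ)
    refine key hdet fun Q hQ hQΛ => ?_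
    have hQ' : Q = (M.noiseFeedthrough θ₁)⁻¹ *
        M.noiseFeedthrough θ₀ := by
      rw [hQ, ← Matrix.mul_assoc, Matrix.nonsing_inv_mul _ (isUnit_iff_ne_zero.2 (hdet θ₁ h₁)),
        Matrix.one_mul]
    have hinv := BlockTriangular.inv' (hE θ₁ h₁) (hdet θ₁ h₁)
    have hQtri : Q.BlockTriangular (b ∘ Subtype.val) := hQ' ▸ hinv.mul (hE θ₀ h₀)
    have hQ1 : ∀ c, Q c c = 1 := fun c => by
      rw [hQ', BlockTriangular.mul_diag hbC hinv (hE θ₀ h₀), hE1 θ₀ h₀,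
        BlockTriangular.inv_diag hbC (hE θ₁ h₁) (hdet θ₁ h₁) (hE1 θ₁ h₁), one_mul]
    exact BlockTriangular.eq_one_of_isDiag hbC hQtri (BlockTriangular.det_ne_zero hbC hQtri hQ1)
      hQ1 (hdiag θ₀ h₀) (hdiag θ₁ h₁)
      (fun a => ((hreg θ₀ h₀).Λ_posDef (hspec θ₀ h₀)).diag_pos.ne') hQΛ

end NetworkModelSet

theorem IsDisconnecting.mono_left {V : Type*} {E : V → V → Prop} {A A' B D : Set V}
    (h : IsDisconnecting E A B D) (hA : A' ⊆ A) : IsDisconnecting E A' B D :=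
  fun p ⟨h1, h2, ⟨a, ha, ha'⟩, h4⟩ => h p ⟨h1, h2, ⟨a, hA ha, ha'⟩, h4⟩

namespace NetworkModelSet

variable {L K n : ℕ} {M : NetworkModelSet L K n} {θ θ₀ θ₁ : Fin n → ℝ}

/-! ### Responses to the external and internal signals -/

theorem IsRegularAt.one_sub_G_mul_T (h : M.IsRegularAt θ) : (1 - M.G θ) * M.T θ = 1 :=
  Matrix.mul_nonsing_inv _ h.isUnit_det

theorem IsRegularAt.T_mul_one_sub_G (h : M.IsRegularAt θ) : M.T θ * (1 - M.G θ) = 1 :=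
  Matrix.nonsing_inv_mul _ h.isUnit_det

theorem systemMatrix_mulVec (y : Fin L → RatFunc ℝ) (u : M.Ext → RatFunc ℝ) :
    M.systemMatrix θ *ᵥ Sum.elim y u = (M.G θ - 1) *ᵥ y + M.X θ *ᵥ u := by
  rw [systemMatrix, Matrix.fromCols_mulVec]
  simp

theorem IsRegularAt.systemMatrix_mulVec_response (h : M.IsRegularAt θ) (u : M.Ext → RatFunc ℝ) :
    M.systemMatrix θ *ᵥ Sum.elim ((M.T θ * M.X θ) *ᵥ u) u = 0 := by
  have h1 : (M.G θ - 1) * (M.T θ * M.X θ) = -M.X θ := by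
    rw [← Matrix.mul_assoc, ← neg_sub, Matrix.neg_mul, h.one_sub_G_mul_T, Matrix.neg_mul,
      Matrix.one_mul]
  rw [systemMatrix_mulVec, Matrix.mulVec_mulVec, h1, Matrix.neg_mulVec, neg_add_cancel]

theorem X_eq_zero_of_outDegree {x : M.Ext} {a b : Fin L} (hx : M.outDegree (Sum.inr x) = 1)
    (ha : M.HasEdgeTo (Sum.inr x) a) (hb : b ≠ a) (hθ : θ ∈ M.Θ) : M.X θ b x = 0 := by
  by_contra hne
  obtain ⟨u, hu⟩ := Set.ncard_eq_one.1 hx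
  have h1 : (Sum.inl a : M.Vert) ∈ {u | M.Edge (Sum.inr x) u} := ⟨a, rfl, ha⟩
  have h2 : (Sum.inl b : M.Vert) ∈ {u | M.Edge (Sum.inr x) u} :=
    ⟨b, rfl, θ, hθ, by simpa [entry] using hne⟩
  rw [hu] at h1 h2
  exact hb (Sum.inl.inj (h2.trans h1.symm))

theorem X_ne_zero_of_known {x : M.Ext} {a : Fin L} (h : M.HasKnownEdgeTo (Sum.inr x) a)
    (hθ : θ ∈ M.Θ) : M.X θ a x ≠ 0 := by
  obtain ⟨⟨θ', hθ', hne⟩, hk⟩ := h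
  rw [hk θ' hθ' θ hθ] at hne
  simpa [entry] using hne

theorem response_eq_of_outDegree {x : M.Ext} {a : Fin L} (hx : M.outDegree (Sum.inr x) = 1)
    (ha : M.HasEdgeTo (Sum.inr x) a) (hθ : θ ∈ M.Θ) (c : Fin L) :
    (M.T θ * M.X θ) c x = M.T θ c a * M.X θ a x := by
  rw [Matrix.mul_apply]
  refine Finset.sum_eq_single a (fun b _ hb => ?_) (by simp)
  rw [X_eq_zero_of_outDegree hx ha hb hθ, mul_zero]

/-- The response to an internal signal is determined by the response to an external signal of
out-degree one that excites it through a known edge. -/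
theorem T_eq_of_response_eq {x : M.Ext} {a : Fin L} (hx : M.outDegree (Sum.inr x) = 1)
    (ha : M.HasKnownEdgeTo (Sum.inr x) a) (h₀ : θ₀ ∈ M.Θ) (h₁ : θ₁ ∈ M.Θ) {c : Fin L}
    (h : (M.T θ₀ * M.X θ₀) c x = (M.T θ₁ * M.X θ₁) c x) : M.T θ₀ c a = M.T θ₁ c a := by
  rw [response_eq_of_outDegree hx ha.1 h₀, response_eq_of_outDegree hx ha.1 h₁] at h
  have h2 : M.X θ₀ a x = M.X θ₁ a x := by
    simpa [entry] using ha.2 θ₀ h₀ θ₁ h₁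
  rw [h2] at h
  exact mul_right_cancel₀ (X_ne_zero_of_known ha h₁) h

/-- External signals whose excitations are linearly independent in the presence of a linking have
linearly independent responses. -/
theorem IsRegularAt.eq_zero_of_response_eq_zero (h : M.IsRegularAt θ) {c : Fin L → M.Vert}
    (hc : Function.Injective c) (hdet : ((M.systemMatrix θ).submatrix id c).det ≠ 0)
    {Cbar : Set (Fin L)} (hcC : ∀ w ∉ Cbar, Sum.inl w ∈ Set.range c) {u : M.Ext → RatFunc ℝ}
    (hu : ∀ x, u x ≠ 0 → Sum.inr x ∈ Set.range c)
    (h0 : ∀ w ∈ Cbar, ((M.T θ * M.X θ) *ᵥ u) w = 0) : u = 0 := by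
  -- The internal responses together with their input form a kernel vector of `[G - I X]`. It
  -- vanishes off the columns chosen by `c`, so the nonsingular submatrix kills it.
  set z : M.Vert → RatFunc ℝ := Sum.elim ((M.T θ * M.X θ) *ᵥ u) u with hz
  have hsupp : ∀ v ∉ Set.range c, z v = 0 := by
    rintro (w | x) hv
    · exact h0 w (by_contra fun hw => hv (hcC w hw))
    · exact by_contra fun hx => hv (hu x hx)
  have hmul : (M.systemMatrix θ).submatrix id c *ᵥ (z ∘ c) = 0 := by
    rw [← h.systemMatrix_mulVec_response u]
    ext a
    exact Fintype.sum_of_injective c hc _ _ (fun v hv => mul_eq_zero_of_right _ (hsupp v hv))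
      fun b => rfl
  have hzc : z ∘ c = 0 := by
    by_contra hne
    exact hdet (Matrix.exists_mulVec_eq_zero_iff.1 ⟨_, hne, hmul⟩)
  ext x
  by_cases hx : (Sum.inr x : M.Vert) ∈ Set.range c
  · obtain ⟨b, hb⟩ := hx
    have := congrFun hzc b
    simpa [hb, hz] using this
  · exact by_contra fun hne => hx (hu x hne)

/-! ### Factorization at a disconnecting set -/

/-- The signals that satisfy the network equations at the internal signals in `B`, and vanish at the
external signals in `B`. -/
def localSolutions (M : NetworkModelSet L K n) (θ : Fin n → ℝ) (B : Set M.Vert) :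
    Submodule (RatFunc ℝ) (M.Vert → RatFunc ℝ) where
  carrier := {z | (∀ a, Sum.inl a ∈ B → (M.systemMatrix θ *ᵥ z) a = 0) ∧
    ∀ x, Sum.inr x ∈ B → z (Sum.inr x) = 0}
  add_mem' := by
    rintro z y ⟨hz, hz'⟩ ⟨hy, hy'⟩
    refine ⟨fun a ha => ?_, fun x hx => by simp [hz' x hx, hy' x hx]⟩
    simp [Matrix.mulVec_add, hz a ha, hy a ha]
  zero_mem' := by simp
  smul_mem' := by
    rintro r z ⟨hz, hz'⟩
    refine ⟨fun a ha => ?_, fun x hx => by simp [hz' x hx]⟩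
    simp [Matrix.mulVec_smul, hz a ha]

/-- The measured parts of local solutions. -/
noncomputable def localResponses (M : NetworkModelSet L K n) (θ : Fin n → ℝ) (B : Set M.Vert)
    (Cbar : Set (Fin L)) : Submodule (RatFunc ℝ) (Cbar → RatFunc ℝ) :=
  (M.localSolutions θ B).map (LinearMap.funLeft (RatFunc ℝ) (RatFunc ℝ)
    fun c : Cbar => (Sum.inl c.1 : M.Vert))

/-- By the closure condition, edges enter `B` from outside only at vertices of `D`, where `z = 0`.
The equations in `B` become a homogeneous system whose matrix is a principal submatrix of `I - G`,
nonsingular by well-posedness. -/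
theorem IsRegularAt.eq_zero_of_mem_localSolutions (h : M.IsRegularAt θ) (hθ : θ ∈ M.Θ)
    {B D : Set M.Vert} (hB : ∀ u a, M.Edge u (Sum.inl a) → u ∉ D → Sum.inl a ∈ B → u ∈ B)
    {z : M.Vert → RatFunc ℝ} (hz : z ∈ M.localSolutions θ B) (hzD : ∀ v ∈ D, z v = 0)
    {a : Fin L} (ha : Sum.inl a ∈ B) : z (Sum.inl a) = 0 := by
  classical
  set S : Finset (Fin L) := Finset.univ.filter fun a => (Sum.inl a : M.Vert) ∈ B with hS
  have hmem : ∀ a, a ∈ S ↔ (Sum.inl a : M.Vert) ∈ B := by simp [hS]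
  have hmul : (1 - M.G θ).submatrix (Subtype.val : S → Fin L) (Subtype.val : S → Fin L) *ᵥ
      (fun b : S => z (Sum.inl b.1)) = 0 := by
    ext ⟨a, haS⟩
    have haB := (hmem a).1 haS
    have h1 := hz.1 a haB
    have h2 : ∀ x, M.systemMatrix θ a (Sum.inr x) * z (Sum.inr x) = 0 := by
      intro x
      by_cases hxD : (Sum.inr x : M.Vert) ∈ D
      · rw [hzD _ hxD, mul_zero]
      by_cases hxB : (Sum.inr x : M.Vert) ∈ B
      · rw [hz.2 x hxB, mul_zero]
      by_contra hne
      exact hxB (hB _ a ⟨a, rfl, θ, hθ, by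
        simpa [entry, systemMatrix] using left_ne_zero_of_mul hne⟩ hxD haB)
    have h3 : ∀ b ∉ S, M.systemMatrix θ a (Sum.inl b) * z (Sum.inl b) = 0 := by
      intro b hb
      by_cases hbD : (Sum.inl b : M.Vert) ∈ D
      · rw [hzD _ hbD, mul_zero]
      have hab : a ≠ b := by rintro rfl; exact hb haS
      by_contra hne
      exact hb ((hmem b).2 (hB _ a ⟨a, rfl, θ, hθ, by
        simpa [entry, systemMatrix, hab] using left_ne_zero_of_mul hne⟩ hbD haB))
    rw [Matrix.mulVec, dotProduct, Fintype.sum_sum_type,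
      Finset.sum_eq_zero (fun x _ => h2 x), add_zero,
      ← Finset.sum_subset (Finset.subset_univ S) (fun b _ hb => h3 b hb),
      ← Finset.sum_coe_sort] at h1
    simp only [Matrix.mulVec, dotProduct, Matrix.submatrix_apply, Pi.zero_apply]
    rw [← neg_eq_zero, ← Finset.sum_neg_distrib, ← h1]
    refine Finset.sum_congr rfl fun b _ => ?_
    simp only [systemMatrix, Matrix.fromCols_apply_inl, Matrix.sub_apply]
    ring
  by_contra hne
  refine h.det_submatrix_ne_zero S (Matrix.exists_mulVec_eq_zero_iff.1 ⟨_, fun h0 => ?_, hmul⟩)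
  exact hne (congrFun h0 ⟨a, (hmem a).2 ha⟩)

theorem finrank_range_le_of_ker_le {F V W U : Type*} [Field F] [AddCommGroup V] [Module F V]
    [FiniteDimensional F V] [AddCommGroup W] [Module F W] [AddCommGroup U] [Module F U]
    [FiniteDimensional F U] (f : V →ₗ[F] W) (g : V →ₗ[F] U)
    (h : LinearMap.ker g ≤ LinearMap.ker f) :
    Module.finrank F (LinearMap.range f) ≤ Module.finrank F U := by
  have h1 := LinearMap.finrank_range_add_finrank_ker f
  have h2 := LinearMap.finrank_range_add_finrank_ker g
  have h3 := Submodule.finrank_mono h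
  have h4 := Submodule.finrank_le (LinearMap.range g)
  omega

/-- The measured parts of local solutions are determined by their values on a disconnecting set. -/
theorem IsRegularAt.finrank_localResponses_le (h : M.IsRegularAt θ) (hθ : θ ∈ M.Θ)
    {Cbar : Set (Fin L)} {D : Finset M.Vert} :
    Module.finrank (RatFunc ℝ) (M.localResponses θ
      (reachAvoiding M.Edge (Sum.inl '' Cbar) D) Cbar) ≤ D.card := by
  set B := reachAvoiding M.Edge (Sum.inl '' Cbar) (D : Set M.Vert) with hB
  let f := (LinearMap.funLeft (RatFunc ℝ) (RatFunc ℝ)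
    fun c : Cbar => (Sum.inl c.1 : M.Vert)).domRestrict (M.localSolutions θ B)
  let g := (LinearMap.funLeft (RatFunc ℝ) (RatFunc ℝ)
    fun v : D => (v.1 : M.Vert)).domRestrict (M.localSolutions θ B)
  have hker : LinearMap.ker g ≤ LinearMap.ker f := by
    rintro ⟨z, hz⟩ hzg
    have hzD : ∀ v ∈ (D : Set M.Vert), z v = 0 := fun v hv =>
      congrFun (LinearMap.mem_ker.1 hzg) ⟨v, hv⟩
    rw [LinearMap.mem_ker]
    ext ⟨c, hc⟩
    by_cases hcD : (Sum.inl c : M.Vert) ∈ (D : Set M.Vert)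
    · exact hzD _ hcD
    · exact h.eq_zero_of_mem_localSolutions hθ
        (fun u a hua hu ha => mem_reachAvoiding_of_rel hua hu ha) hz hzD
        (mem_reachAvoiding_of_mem ⟨c, hc, rfl⟩ hcD)
  have h1 := finrank_range_le_of_ker_le f g hker
  rw [Module.finrank_pi, Fintype.card_coe] at h1
  rwa [localResponses, ← LinearMap.range_domRestrict]

theorem IsRegularAt.response_mem_localResponses (h : M.IsRegularAt θ) {B : Set M.Vert}
    (Cbar : Set (Fin L)) {x : M.Ext} (hx : Sum.inr x ∉ B) :
    (fun c : Cbar => (M.T θ * M.X θ) c.1 x) ∈ M.localResponses θ B Cbar := by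
  classical
  refine ⟨Sum.elim ((M.T θ * M.X θ) *ᵥ Pi.single x 1) (Pi.single x 1), ⟨fun a _ => ?_,
    fun y hy => ?_⟩, ?_⟩
  · rw [h.systemMatrix_mulVec_response]
    rfl
  · have : y ≠ x := by rintro rfl; exact hx hy
    simp [this]
  · ext c
    simp [LinearMap.funLeft_apply]

/-- A unit disturbance at `w_a`, with no external input, violates only the equation of `w_a`, and
that one is not imposed when `w_a` lies outside `B`. -/
theorem IsRegularAt.T_mem_localResponses (h : M.IsRegularAt θ) {B : Set M.Vert}
    (Cbar : Set (Fin L)) {a : Fin L} (ha : Sum.inl a ∉ B) :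
    (fun c : Cbar => M.T θ c.1 a) ∈ M.localResponses θ B Cbar := by
  classical
  refine ⟨Sum.elim (M.T θ *ᵥ Pi.single a 1) 0, ⟨fun b hb => ?_, fun y hy => by simp⟩, ?_⟩
  · have hba : b ≠ a := by rintro rfl; exact ha hb
    rw [systemMatrix_mulVec, Matrix.mulVec_mulVec, ← neg_sub, Matrix.neg_mul, h.one_sub_G_mul_T]
    simp [hba]
  · ext c
    simp [LinearMap.funLeft_apply]

/-! ### Identifiability -/

/-- The response of the measured signals to all external signals is determined by the data. -/
theorem response_eq (hreg : ∀ θ ∈ M.Θ, M.IsRegularAt θ)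
    (hmonic : ∀ θ ∈ M.Θ, M.IsMonicMinimumPhaseAt θ)
    (hfactor : ∀ θ ∈ M.Θ, M.IsNoiseResponseMinimumPhaseAt θ)
    (hspec : M.HasFullRankSpectrum) (hfeed : M.HasFeedthroughCondition)
    (h₀ : θ₀ ∈ M.Θ) (h₁ : θ₁ ∈ M.Θ)
    (hR : M.measuredRows (M.T θ₀ * M.R) = M.measuredRows (M.T θ₁ * M.R))
    (hΦ : ∀ ω : ℝ, M.measuredSpectrum θ₀ ω = M.measuredSpectrum θ₁ ω) {c : Fin L} (hc : c ∈ M.C)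
    (x : M.Ext) : (M.T θ₀ * M.X θ₀) c x = (M.T θ₁ * M.X θ₁) c x := by
  rw [X, X, Matrix.mul_fromCols, Matrix.mul_fromCols]
  rcases x with k | e
  · exact congrFun (congrFun hR ⟨c, hc⟩) k
  · exact congrFun (congrFun
      (noiseResponse_eq hreg hmonic hfactor hspec hfeed h₀ h₁ hΦ) ⟨c, hc⟩) e

theorem IsRegularAt.T_sub_sum (h : M.IsRegularAt θ) (c i : Fin L) :
    M.T θ c i - ∑ a, M.G θ a i * M.T θ c a = (1 : Matrix (Fin L) (Fin L) (RatFunc ℝ)) c i := by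
  rw [← h.T_mul_one_sub_G, Matrix.mul_sub, Matrix.mul_one, Matrix.sub_apply, Matrix.mul_apply]
  simp only [mul_comm]

end NetworkModelSet

end DynNet

/-! ### Comparison of two models with equal data -/

theorem mainTheorem4 {L K n : ℕ} (M : DynNet.NetworkModelSet L K n)
    -- every model of the set is a regular network model with a monic, minimum phase noise model
    (hreg : ∀ θ ∈ M.Θ, M.IsRegularAt θ)
    (hmonic : ∀ θ ∈ M.Θ, M.IsMonicMinimumPhaseAt θ)
    -- the noise-to-measurement transfer matrix is a minimum phase spectral factor
    (hfactor : ∀ θ ∈ M.Θ, M.IsNoiseResponseMinimumPhaseAt θ)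
    (hspec : M.HasFullRankSpectrum)
    (hindep : M.IsIndependentlyParameterized)
    (hfeed : M.HasFeedthroughCondition)
    (hfixed : M.HasRegularFixedEntries)
    (i j : Fin L) (hi : i ∈ M.C) (hj : j ∉ M.C)
    (xj : M.Ext) (hxj_deg : M.outDegree (Sum.inr xj) = 1)
    (hxj_edge : M.HasKnownEdgeTo (Sum.inr xj) j)
    (Xbar : Set M.Ext) (hXbar : Xbar ⊆ M.XSet j \ {xj})
    (Cbar : Set (Fin L)) (hCbar : Cbar ⊆ (M.C : Set (Fin L))) (hiCbar : i ∈ Cbar)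
    (D : Finset M.Vert)
    (hD : DynNet.IsDisconnecting M.Edge
      (Sum.inl '' (M.NPlus i \ {j}) ∪ Sum.inr '' Xbar ∪ {Sum.inl i}) (Sum.inl '' Cbar) D)
    (h₁ : DynNet.maxDisjointPaths M.Edge ({Sum.inl j} ∪ (D : Set M.Vert)) (Sum.inl '' Cbar)
      = D.card + 1)
    (h₂ : DynNet.maxDisjointPaths M.Edge (Sum.inr '' Xbar) (D : Set M.Vert) = D.card) :
    M.IsGenericallyIdentifiable j i := by
  classical
  obtain ⟨X', c, hX', hX'card, hc, hcE, hcC, hcX⟩ := DynNet.exists_linking (E := M.Edge)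
    (fun u x ⟨a, ha, _⟩ => Sum.inr_ne_inl ha) (j := j) (xj := xj) ⟨j, rfl, hxj_edge.1⟩
    (fun h => (hXbar h).2 rfl)
    (hD.mono_left fun v hv => Or.inl (Or.inr hv)) h₁ h₂
  filter_upwards [M.ae_det_systemMatrix_ne_zero hreg hindep hfixed hc hcE] with θ₀ hdet h₀ θ₁ hθ₁
    hR hΦ
  have hr₀ := hreg θ₀ h₀
  have hr₁ := hreg θ₁ hθ₁
  have hxjX : xj ∉ X' := fun h => (hXbar (hX' h)).2 rfl
  have hY : ∀ w ∈ Cbar, ∀ x, (M.T θ₀ * M.X θ₀) w x = (M.T θ₁ * M.X θ₁) w x := fun w hw =>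
    M.response_eq hreg hmonic hfactor hspec hfeed h₀ hθ₁ hR hΦ (hCbar hw)
  have hindep' : ∀ u : M.Ext → RatFunc ℝ, (∀ x, u x ≠ 0 → x ∈ insert xj (X' : Set M.Ext)) →
      (∀ w ∈ Cbar, ((M.T θ₀ * M.X θ₀) *ᵥ u) w = 0) → u = 0 := fun u hu =>
    hr₀.eq_zero_of_response_eq_zero hc (hdet h₀) hcC fun x hx => hcX x (hu x hx)
  let Y : M.Ext → Cbar → RatFunc ℝ := fun x w => (M.T θ₀ * M.X θ₀) w.1 x
  have hlin : LinearIndependent (RatFunc ℝ) fun x : X' => Y x := by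
    rw [Fintype.linearIndependent_iff]
    intro g hg x
    have h0 := hindep' (fun x => if hx : x ∈ X' then g ⟨x, hx⟩ else 0) (fun y hy => by
      by_contra hyX
      have : y ∉ X' := fun h => hyX (Or.inr h)
      simp [this] at hy) (fun w hw => by
      have h1 := congrFun hg ⟨w, hw⟩
      simp only [Finset.sum_apply, Pi.smul_apply, smul_eq_mul, Pi.zero_apply, Y] at h1
      refine Eq.trans ?_ h1
      rw [Matrix.mulVec, dotProduct, ← Finset.sum_subset (Finset.subset_univ X')
        (fun y _ hy => by simp [hy]), ← Finset.sum_coe_sort]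
      refine Finset.sum_congr rfl fun y _ => ?_
      simp [mul_comm])
    simpa using congrFun h0 x
  set S := Submodule.span (RatFunc ℝ) (Set.range fun x : X' => Y x) with hS
  have hSrank : Module.finrank (RatFunc ℝ) S = D.card := by
    rw [finrank_span_eq_card hlin, Fintype.card_coe, hX'card]
  have hxjS : Y xj ∉ S := by
    intro hmem
    obtain ⟨g, hg⟩ := (Submodule.mem_span_range_iff_exists_fun (RatFunc ℝ)).1 hmem
    have h0 := hindep' (fun x => if hx : x ∈ X' then g ⟨x, hx⟩ else if x = xj then -1 else 0)
      (fun y hy => by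
        by_contra hyX
        have h1 : y ∉ X' := fun h => hyX (Or.inr h)
        have h2 : y ≠ xj := fun h => hyX (Or.inl h)
        simp [h1, h2] at hy) (fun w hw => by
      have h1 := congrFun hg ⟨w, hw⟩
      simp only [Finset.sum_apply, Pi.smul_apply, smul_eq_mul, Y] at h1
      rw [Matrix.mulVec, dotProduct, ← Finset.sum_subset (Finset.subset_univ (insert xj X'))
        (fun y _ hy => by
          rw [Finset.mem_insert, not_or] at hy
          simp [hy.1, hy.2]), Finset.sum_insert hxjX, ← h1, ← Finset.sum_coe_sort X']
      simp [hxjX, mul_comm])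
    have := congrFun h0 xj
    simp [hxjX] at this
  set B := DynNet.reachAvoiding M.Edge (Sum.inl '' Cbar) (D : Set M.Vert) with hB
  have hXB : ∀ x ∈ X', (Sum.inr x : M.Vert) ∉ B := fun x hx =>
    hD.notMem_reachAvoiding (Or.inl (Or.inr ⟨x, hX' hx, rfl⟩))
  -- Equal responses place `S` inside the local response space of either model, and `dim S = |D|` is
  -- the largest dimension possible. Both spaces thus coincide with `S`, although `T(θ₁)` is
  -- otherwise unknown.
  have hSK : ∀ θ, M.IsRegularAt θ → θ ∈ M.Θ →
      (∀ w ∈ Cbar, ∀ x, (M.T θ₀ * M.X θ₀) w x = (M.T θ * M.X θ) w x) →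
      S = M.localResponses θ B Cbar := by
    intro θ hr hθ hYθ
    refine Submodule.eq_of_le_of_finrank_le (Submodule.span_le.2 ?_) ?_
    · rintro _ ⟨x, rfl⟩
      have hYx : Y x = fun w : Cbar => (M.T θ * M.X θ) w.1 x := funext fun w => hYθ w w.2 x
      change Y x ∈ _
      rw [hYx]
      exact hr.response_mem_localResponses Cbar (hXB x x.2)
    · rw [hSrank]
      exact hr.finrank_localResponses_le hθ
  have hcol : ∀ a, (Sum.inl a : M.Vert) ∉ B → (fun w : Cbar => M.T θ₀ w.1 a) ∈ S ∧
      (fun w : Cbar => M.T θ₁ w.1 a) ∈ S := by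
    intro a ha
    constructor
    · rw [hSK θ₀ hr₀ h₀ fun _ _ _ => rfl]
      exact hr₀.T_mem_localResponses Cbar ha
    · rw [hSK θ₁ hr₁ hθ₁ hY]
      exact hr₁.T_mem_localResponses Cbar ha
  have hiS := hcol i (hD.notMem_reachAvoiding (Or.inr rfl))
  -- the contributions of the modules from `w_i` to the signals other than `w_j`
  have hterm : ∀ a, a ≠ j → (M.G θ₀ a i • (fun w : Cbar => M.T θ₀ w.1 a) -
      M.G θ₁ a i • fun w : Cbar => M.T θ₁ w.1 a) ∈ S := by
    intro a haj
    by_cases ha : a ∈ M.NPlus i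
    · obtain ⟨h3, h4⟩ := hcol a
        (hD.notMem_reachAvoiding (Or.inl (Or.inl ⟨a, ⟨ha, haj⟩, rfl⟩)))
      exact S.sub_mem (S.smul_mem _ h3) (S.smul_mem _ h4)
    -- Outside `𝒩_i⁺` the two contributions cancel exactly: either there is no edge, or the module
    -- is known and its target is excited through a known edge by a signal of out-degree one, so its
    -- column of `T` is determined by the data.
    · by_cases hedge : M.HasEdgeTo (Sum.inl i) a
      · obtain ⟨hk, x, hx, hxa⟩ := not_not.1 fun h => ha ⟨hedge, h⟩
        have hG : M.G θ₀ a i = M.G θ₁ a i := hk.2 θ₀ h₀ θ₁ hθ₁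
        have hT : (fun w : Cbar => M.T θ₀ w.1 a) = fun w : Cbar => M.T θ₁ w.1 a :=
          funext fun w => M.T_eq_of_response_eq hx hxa h₀ hθ₁ (hY w w.2 x)
        rw [hG, hT, sub_self]
        exact S.zero_mem
      · have hG : ∀ θ ∈ M.Θ, M.G θ a i = 0 := fun θ hθ =>
          by_contra fun hne => hedge ⟨θ, hθ, hne⟩
        rw [hG θ₀ h₀, hG θ₁ hθ₁]
        simp
  have hTj : (fun w : Cbar => M.T θ₁ w.1 j) = fun w : Cbar => M.T θ₀ w.1 j :=
    funext fun w => (M.T_eq_of_response_eq hxj_deg hxj_edge h₀ hθ₁ (hY w w.2 xj)).symm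
  -- Column `i` of `T (I - G) = I` has the same right-hand side for both models, and column `j` of
  -- `T` is common to both. In the difference, every term but that of `w_j` is already known to lie
  -- in `S`.
  have hdiff : (M.G θ₀ j i - M.G θ₁ j i) • (fun w : Cbar => M.T θ₀ w.1 j) ∈ S := by
    have heq : (M.G θ₀ j i - M.G θ₁ j i) • (fun w : Cbar => M.T θ₀ w.1 j) =
        ((fun w : Cbar => M.T θ₀ w.1 i) - fun w : Cbar => M.T θ₁ w.1 i) -
          ∑ a ∈ Finset.univ.erase j, (M.G θ₀ a i • (fun w : Cbar => M.T θ₀ w.1 a) -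
            M.G θ₁ a i • fun w : Cbar => M.T θ₁ w.1 a) := by
      ext w
      have e1 := hr₀.T_sub_sum w.1 i
      have e2 := hr₁.T_sub_sum w.1 i
      have e3 := congrFun hTj w
      rw [← Finset.add_sum_erase _ _ (Finset.mem_univ j)] at e1 e2
      simp only [Pi.smul_apply, Pi.sub_apply, smul_eq_mul, Finset.sum_apply,
        Finset.sum_sub_distrib] at e3 ⊢
      rw [e3] at e2
      linear_combination e2 - e1
    rw [heq]
    exact S.sub_mem (S.sub_mem hiS.1 hiS.2)
      (S.sum_mem fun a ha => hterm a (Finset.ne_of_mem_erase ha))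
  by_contra hne
  apply hxjS
  have hjS := (S.smul_mem_iff (sub_ne_zero.2 hne)).1 hdiff
  have hYj : Y xj = M.X θ₀ j xj • fun w : Cbar => M.T θ₀ w.1 j := by
    ext w
    exact (M.response_eq_of_outDegree hxj_deg hxj_edge.1 h₀ w.1).trans (mul_comm _ _)
  rw [hYj]
  exact S.smul_mem _ hjS
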